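/- Let $m\ge 4$ and let $R$ be a commutative unital ring. Let $K_m$ be the complete graph on the vertices $1,\dots,m$, and let $C_m$ be Munkres' simplicial model of the configuration space of two ordered points on $|K_m|$: its vertices are the columns $\genfrac{}{}{0pt}{1}{a}{b}$ with $a,b\in\{1,\dots,m\}$, $a\neq b$, and its simplices are the nonempty sets of such vertices which form a chain for the componentwise order and whose set of first entries and set of second entries each have at most two elements (the simplices of the ordered product $K_m\times K_m$ which are disjoint from the diagonal). A simplex is written as the matrix of its vertices in increasing order. Order the vertices lexicographically. Let $W_m$ be the matching on the faces of $C_m$ constructed by the following algorithm. With $d=\dim C_m$, for $i=d-1,\dots,0$, then for $r=i+1,\dots,0$, then for each vertex $v$ from the largest to the smallest, then for each $i$-face $\alpha$ in lexicographic order: if $\alpha\cup\{v\}$ is an $(i+1)$-face in which $v$ appears in position $r$ (counting from $0$), and if neither $\alpha$ nor $\alpha\cup\{v\}$ has been paired yet, add the pairing $\alpha\nearrow\alpha\cup\{v\}$. A face is critical if it takes part in no pairing. The Morse chain module $\mu_p(C_m)$ is the free $R$-module on the critical $p$-faces, and the coefficient of a critical face $\alpha^{(p)}$ in $\partial\beta$,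 for a critical face $\beta^{(p+1)}$, is the sum of the multiplicities of all mixed paths $$\beta\searrow\alpha_0\nearrow\beta_1\searrow\alpha_1\nearrow\cdots\nearrow\beta_k\searrow\alpha_k=\alpha\qquad(k\ge 0),$$ where each $\nearrow$ is a pairing in $W_m$ and each $\searrow$ is the passage to a facet which is not reversed by $W_m$; with $\iota_{\sigma,\tau}=\pm1$ the coefficient of $\sigma$ in the simplicial boundary of $\tau$, the multiplicity of this path is $\iota_{\alpha_0,\beta}\prod_{j=1}^{k}\left(-\iota_{\alpha_{j-1},\beta_j}\,\iota_{\alpha_j,\beta_j}\right)$. The Morse cochain complex $(\mu^*(C_m),\delta)$ is the dual of $(\mu_*(C_m),\partial)$; the dual basis element of a critical face is denoted by the same symbol as the face. The matching $W_m$ is a gradient field (there are no non-constant cycles of upper paths $\alpha_0\nearrow\beta_1\searrow\alpha_1\nearrow\cdots\searrow\alpha_k=\alpha_0$), its critical $1$-faces are exactly the simplices of the types - (k.1): $\left[\begin{smallmatrix}a&m-1\\ b&m\end{smallmatrix}\right]$ with $a\ne b$ and either $a=m-1>b+1$ or $a<m-1\ge b$, - (k.2): $\left[\begin{smallmatrix}m&m\\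 b&d\end{smallmatrix}\right]$ with $b<d<m-1$, - (k.3): $\left[\begin{smallmatrix}a&c\\ m&m\end{smallmatrix}\right]$ with $a<c<m-1$, and its critical $2$-faces are exactly the simplices $\left[\begin{smallmatrix}a&a&c\\ b&d&d\end{smallmatrix}\right]$ with $a<c<m$, $b<d<m$, $a\notin\{b,d\}$ and $c\notin\{b,d\}$ (all entries in $\{1,\dots,m\}$). Moreover: 1. $\delta\colon\mu^1(C_m)\to\mu^2(C_m)$ vanishes on the duals of the critical faces of types (k.2) and (k.3). 2. For the dual of every critical face of type (k.1), $$\delta\left(\begin{bmatrix}a&m-1\\ b&m\end{bmatrix}\right)=\sum\begin{bmatrix}a&a&x\\ y&b&b\end{bmatrix}-\sum\begin{bmatrix}a&a&x\\ b&y&y\end{bmatrix}+\sum\begin{bmatrix}x&x&a\\ b&y&y\end{bmatrix}-\sum\begin{bmatrix}x&x&a\\ y&b&b\end{bmatrix},$$ where the sums run over all $x,y$ which render critical $2$-faces. Explicitly, these are the $x,y\in\{1,\dots,m\}$ such that: $a<x<m$ in the first and second sums; $x<a$ in the third and fourth sums; $b<y<m$ in the second and third sums; $y<b$ in the first and fourth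 sums; and $b\ne x$, $x\ne y$, $y\ne a$ in all four sums. 3. Equivalently, for a critical $2$-face $\left[\begin{smallmatrix}a&a&c\\ b&d&d\end{smallmatrix}\right]$ with $(c,d)\neq(m-1,m-2)$, the Morse boundary $\partial\colon\mu_2(C_m)\to\mu_1(C_m)$ is given by $$\partial\begin{bmatrix}a&a&c\\ b&d&d\end{bmatrix}=\begin{bmatrix}a&m-1\\ d&m\end{bmatrix}-\begin{bmatrix}a&m-1\\ b&m\end{bmatrix}+\begin{bmatrix}c&m-1\\ b&m\end{bmatrix}-\begin{bmatrix}c&m-1\\ d&m\end{bmatrix},$$ whereas for $(c,d)=(m-1,m-2)$ $$\partial\begin{bmatrix}a&a&m-1\\ b&m-2&m-2\end{bmatrix}=\begin{bmatrix}a&m-1\\ m-2&m\end{bmatrix}-\begin{bmatrix}a&m-1\\ b&m\end{bmatrix}+\begin{bmatrix}m-1&m-1\\ b&m\end{bmatrix}.$$ -/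

import Mathlib

noncomputable section

/-- A finite abstract simplicial complex whose vertices lie in `V` (not every element of `V` has to
be a vertex). -/
structure FinComplex (V : Type) extends PreAbstractSimplicialComplex V where
  finite_faces : faces.Finite

namespace FinComplex

variable {V : Type}

section General

/-- The finite set of all faces. -/
def faceFinset (K : FinComplex V) : Finset (Finset V) := K.finite_faces.toFinset

/-- The set of `i`-dimensional faces, i.e. of faces with `i + 1` vertices. -/
def facesOfDim (K : FinComplex V) (i : ℕ) : Finset (Finset V) :=
  {σ ∈ K.faceFinset | σ.card = i + 1}

/-- The dimension of the complex (`0` for the empty complex). -/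
def dim (K : FinComplex V) : ℕ := K.faceFinset.sup fun σ => σ.card - 1

/-- The vertices of the complex. -/
def vertices [DecidableEq V] (K : FinComplex V) : Finset V := K.faceFinset.biUnion id

end General

section Algorithm

variable [LinearOrder V]

/-- The vertices, from the largest one to the smallest one. -/
def verticesDescending (K : FinComplex V) : List V := (K.vertices.sort (· ≤ ·)).reverse

/-- The `i`-dimensional faces in lexicographic order, a face being compared through the increasing
tuple of its vertices. -/
def facesLex (K : FinComplex V) (i : ℕ) : List (Finset V) :=
  (((K.facesOfDim i).image fun α => α.sort (· ≤ ·)).sort (· ≤ ·)).map List.toFinset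

/-- The sequence of all instructions `(i, r, v, α)` of the algorithm, in order of execution:
`i = d - 1, …, 0`, then `r = i + 1, …, 0`, then `v` from the largest vertex to the smallest, then
the `i`-dimensional faces `α` in lexicographic order. -/
def instructions (K : FinComplex V) : List (ℕ × ℕ × V × Finset V) :=
  (List.range K.dim).reverse.flatMap fun i =>
    (List.range (i + 2)).reverse.flatMap fun r =>
      K.verticesDescending.flatMap fun v =>
        (K.facesLex i).map fun α => (i, r, v, α)

/-- One instruction. The state is `(W, F)`: the pairings constructed so far, and the faces (of all
dimensions) which are still unpaired. The instruction `(i, r, v, α)` adds the pairing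
`(α, α ∪ {v})` provided `α ∪ {v}` is an `(i + 1)`-face in which `v` appears in position `r`
(positions are counted from `0`) and both `α` and `α ∪ {v}` are still unpaired. (When there are no
unpaired faces in dimension `i` or in dimension `i + 1`, nothing happens.) -/
def step (K : FinComplex V) (s : Finset (Finset V × Finset V) × Finset (Finset V))
    (c : ℕ × ℕ × V × Finset V) : Finset (Finset V × Finset V) × Finset (Finset V) :=
  match c with
  | (i, r, v, α) =>
    if insert v α ∈ K.facesOfDim (i + 1) ∧ {u ∈ α | u < v}.card = r ∧
        α ∈ s.2 ∧ insert v α ∈ s.2 then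
      (insert (α, insert v α) s.1, (s.2.erase α).erase (insert v α))
    else s

/-- The matching constructed by the algorithm: a pairing `α ↗ β` is recorded as `(α, β)`. -/
def gradientField (K : FinComplex V) : Finset (Finset V × Finset V) :=
  (K.instructions.foldl K.step (∅, K.faceFinset)).1

end Algorithm

section Morse

variable [LinearOrder V]

/-- The incidence number of `α` and `β`: the coefficient of `α` in the simplicial boundary
`∑ j, (-1) ^ j • [v₀, …, v̂ⱼ, …, vᵢ]` of `β = [v₀, …, vᵢ]`, vertices being listed increasingly. -/
def incidence (α β : Finset V) : ℤ :=
  ∑ v ∈ β, if β.erase v = α then (-1) ^ {u ∈ β | u < v}.card else 0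

/-- A down-going edge `β ↘ α` of the Hasse diagram modified by `W`: `α` is a face of `β` of
codimension one, and the edge is not reversed by `W`. -/
def DownEdge (K : FinComplex V) (W : Finset (Finset V × Finset V)) (β α : Finset V) : Prop :=
  β ∈ K.faceFinset ∧ α ∈ K.faceFinset ∧ α ⊆ β ∧ β.card = α.card + 1 ∧ (α, β) ∉ W

/-- Upper paths `α₀ ↗ β₁ ↘ α₁ ↗ ⋯ ↗ βₖ ↘ αₖ` from `α₀` to `αₖ`, for `k ≥ 0`. -/
inductive UpperPath (K : FinComplex V) (W : Finset (Finset V × Finset V)) :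
    Finset V → Finset V → Type
  | const (α : Finset V) : UpperPath K W α α
  | cons {α₀ β₁ α₁ α : Finset V} (up : (α₀, β₁) ∈ W) (down : DownEdge K W β₁ α₁)
      (tail : UpperPath K W α₁ α) : UpperPath K W α₀ α

/-- The multiplicity of an upper path: multiplicative, and equal to
`-ι(α₀, β₁) * ι(α₁, β₁)` on an elementary path `α₀ ↗ β₁ ↘ α₁`. -/
def UpperPath.mult {K : FinComplex V} {W : Finset (Finset V × Finset V)} :
    {α₀ α : Finset V} → UpperPath K W α₀ α → ℤ
  | _, _, .const _ => 1
  | α₀, _, .cons (β₁ := β₁) (α₁ := α₁) _ _ tail =>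
      -(incidence α₀ β₁ * incidence α₁ β₁) * tail.mult

/-- Mixed paths from `β` to `α`: an edge `β ↘ γ` followed by an upper path from `γ` to `α`. -/
structure MixedPath (K : FinComplex V) (W : Finset (Finset V × Finset V)) (β α : Finset V) where
  mid : Finset V
  down : DownEdge K W β mid
  upper : UpperPath K W mid α

/-- The multiplicity of a mixed path. -/
def MixedPath.mult {K : FinComplex V} {W : Finset (Finset V × Finset V)} {β α : Finset V}
    (l : MixedPath K W β α) : ℤ :=
  incidence l.mid β * l.upper.mult

/-- `W` is a gradient field: it consists of pairs `(α, β)` of faces with `α` a facet of `β`, each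
face takes part in at most one pair, and the modified Hasse diagram has no cycles, i.e. there is no
non-constant upper path from a face to itself. (A lower cycle is the same thing as an upper cycle
read from a different starting face.) -/
structure IsGradientField (K : FinComplex V) (W : Finset (Finset V × Finset V)) : Prop where
  facet : ∀ p ∈ W, p.1 ∈ K.faceFinset ∧ p.2 ∈ K.faceFinset ∧ p.1 ⊆ p.2 ∧ p.2.card = p.1.card + 1
  matching : ∀ p ∈ W, ∀ q ∈ W,
    (p.1 = q.1 ∨ p.1 = q.2 ∨ p.2 = q.1 ∨ p.2 = q.2) → p = q
  acyclic : ∀ α,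
    ¬ Relation.TransGen (fun α γ => ∃ β, (α, β) ∈ W ∧ DownEdge K W β γ) α α

open Classical in
/-- The critical `p`-faces of `W`: those which are neither redundant nor collapsible. -/
def criticalFaces (K : FinComplex V) (W : Finset (Finset V × Finset V)) (p : ℕ) :
    Finset (Finset V) :=
  {σ ∈ K.facesOfDim p | ∀ e ∈ W, e.1 ≠ σ ∧ e.2 ≠ σ}

variable (R : Type*) [CommRing R]

/-- The Morse chains of degree `p`: the free `R`-module on the critical `p`-faces. -/
abbrev MorseChain (K : FinComplex V) (W : Finset (Finset V × Finset V)) (p : ℕ) : Type _ :=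
  {σ // σ ∈ K.criticalFaces W p} →₀ R

/-- The Morse boundary map: the coefficient of a critical face `α` in the boundary of a critical
face `β` is the sum of the multiplicities of all mixed paths from `β` to `α` (this is a finite sum
when `W` is a gradient field). -/
def morseBoundary (K : FinComplex V) (W : Finset (Finset V × Finset V)) (p : ℕ) :
    MorseChain R K W (p + 1) →ₗ[R] MorseChain R K W p :=
  Finsupp.linearCombination R fun β : {σ // σ ∈ K.criticalFaces W (p + 1)} =>
    ∑ α : {σ // σ ∈ K.criticalFaces W p},
      Finsupp.single α (((∑ᶠ l : MixedPath K W β.1 α.1, l.mult : ℤ)) : R)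

/-- The Morse cochains of degree `p`. -/
abbrev MorseCochain (K : FinComplex V) (W : Finset (Finset V × Finset V)) (p : ℕ) : Type _ :=
  Module.Dual R (MorseChain R K W p)

/-- The Morse coboundary map, the dual of the Morse boundary map. -/
def morseCoboundary (K : FinComplex V) (W : Finset (Finset V × Finset V)) (p : ℕ) :
    MorseCochain R K W p →ₗ[R] MorseCochain R K W (p + 1) :=
  (morseBoundary R K W p).dualMap

open Classical in
/-- The basis element of the Morse chains given by a critical `p`-face `σ`. For convenience it is
defined to be `0` when `σ` is not a critical `p`-face. -/
def morseCell (K : FinComplex V) (W : Finset (Finset V × Finset V)) (p : ℕ) (σ : Finset V) :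
    MorseChain R K W p :=
  if h : σ ∈ K.criticalFaces W p then Finsupp.single ⟨σ, h⟩ 1 else 0

open Classical in
/-- The dual basis element of the Morse cochains given by a critical `p`-face `σ`, i.e. the
functional reading off the coefficient of `σ`. For convenience it is defined to be `0` when `σ` is
not a critical `p`-face. -/
def morseDual (K : FinComplex V) (W : Finset (Finset V × Finset V)) (p : ℕ) (σ : Finset V) :
    MorseCochain R K W p :=
  if h : σ ∈ K.criticalFaces W p then Finsupp.lapply ⟨σ, h⟩ else 0

end Morse

section Configuration

variable [LinearOrder V]

/-- The ordered product `K × K`. A `k`-simplex is a set of `k + 1` pairs which is a chain for the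
componentwise order and whose two projections are faces of `K`. The vertex set `V × V` carries the
lexicographic linear order, which extends the componentwise one. -/
def orderedSquare (K : FinComplex V) : FinComplex (V ×ₗ V) where
  faces := {σ | σ.Nonempty ∧
    IsChain (fun p q : V ×ₗ V => ofLex p ≤ ofLex q) (σ : Set (V ×ₗ V)) ∧
    σ.image (fun p => (ofLex p).1) ∈ K.faces ∧ σ.image (fun p => (ofLex p).2) ∈ K.faces}
  isRelLowerSet_faces := by
    rintro σ ⟨hne, hc, h1, h2⟩
    refine ⟨hne, fun τ hτ hτne => ⟨hτne, hc.mono (by exact_mod_cast hτ), ?_, ?_⟩⟩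
    · exact (K.isRelLowerSet_faces h1).2 (Finset.image_subset_image hτ) (hτne.image _)
    · exact (K.isRelLowerSet_faces h2).2 (Finset.image_subset_image hτ) (hτne.image _)
  finite_faces := by
    refine (((K.vertices ×ˢ K.vertices).map toLex.toEmbedding).powerset.finite_toSet).subset ?_
    rintro σ ⟨-, -, h1, h2⟩
    simp only [Finset.coe_powerset, Set.mem_preimage, Set.mem_powerset_iff, Finset.coe_subset]
    intro p hp
    refine Finset.mem_map.2 ⟨ofLex p, Finset.mem_product.2 ⟨?_, ?_⟩, rfl⟩
    · exact Finset.mem_biUnion.2 ⟨_, K.finite_faces.mem_toFinset.2 h1,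
        Finset.mem_image_of_mem (fun p : V ×ₗ V => (ofLex p).1) hp⟩
    · exact Finset.mem_biUnion.2 ⟨_, K.finite_faces.mem_toFinset.2 h2,
        Finset.mem_image_of_mem (fun p : V ×ₗ V => (ofLex p).2) hp⟩

/-- Munkres' model of the configuration space of two ordered points on `|K|`: the subcomplex of the
ordered product `K × K` of all simplices disjoint from the diagonal, that is, of all simplices
without a vertex on the diagonal. -/
def munkresModel (K : FinComplex V) : FinComplex (V ×ₗ V) where
  faces := {σ | σ ∈ K.orderedSquare.faces ∧ ∀ p ∈ σ, (ofLex p).1 ≠ (ofLex p).2}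
  isRelLowerSet_faces := by
    rintro σ ⟨hσ, hd⟩
    exact ⟨hσ.1, fun τ hτ hτne =>
      ⟨(K.orderedSquare.isRelLowerSet_faces hσ).2 hτ hτne, fun p hp => hd p (hτ hp)⟩⟩
  finite_faces := K.orderedSquare.finite_faces.subset fun _ h => h.1

end Configuration

/-- The complete graph on `1, …, m`, as a simplicial complex. -/
def completeGraph (m : ℕ) : FinComplex ℕ where
  faces := {σ | σ.Nonempty ∧ σ ⊆ Finset.Icc 1 m ∧ σ.card ≤ 2}
  isRelLowerSet_faces := by
    rintro σ ⟨hne, hs, hc⟩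
    exact ⟨hne, fun τ hτ hτne =>
      ⟨hτne, Finset.Subset.trans hτ hs, (Finset.card_le_card hτ).trans hc⟩⟩
  finite_faces := ((Finset.Icc 1 m).powerset.finite_toSet).subset fun σ h =>
    Finset.mem_coe.2 (Finset.mem_powerset.2 h.2.1)

end FinComplex

/-- Munkres' model `C_m` of the configuration space of two ordered points on the complete graph. -/
def confComplex (m : ℕ) : FinComplex (ℕ ×ₗ ℕ) := (FinComplex.completeGraph m).munkresModel

/-- The gradient field `W_m` which the algorithm constructs on `C_m`, with respect to the
lexicographic order of the vertices. -/
def confField (m : ℕ) : Finset (Finset (ℕ ×ₗ ℕ) × Finset (ℕ ×ₗ ℕ)) := (confComplex m).gradientField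

/-- The critical `p`-faces of `C_m` with respect to `W_m`. -/
def confCritical (m p : ℕ) : Finset (Finset (ℕ ×ₗ ℕ)) :=
  (confComplex m).criticalFaces (confField m) p

/-- The set of columns of a matrix with two rows: matrix notation for the simplices of `C_m`. -/
def cols {k : ℕ} (M : Matrix (Fin 2) (Fin k) ℕ) : Finset (ℕ ×ₗ ℕ) :=
  Finset.univ.image fun j => toLex (M 0 j, M 1 j)

/-- The parameters `a, b` of the critical `1`-faces `[a, m-1; b, m]` of type (k.1). -/
def TypeK1 (m a b : ℕ) : Prop :=
  1 ≤ a ∧ 1 ≤ b ∧ a ≠ b ∧ ((a = m - 1 ∧ b + 1 < m - 1) ∨ (a < m - 1 ∧ b ≤ m - 1))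

/-- The parameters `b, d` of the critical `1`-faces `[m, m; b, d]` of type (k.2); also the
parameters `a, c` of the critical `1`-faces `[a, c; m, m]` of type (k.3). -/
def TypeK23 (m b d : ℕ) : Prop := 1 ≤ b ∧ b < d ∧ d < m - 1

/-- The parameters `a, b, c, d` of the critical `2`-faces `[a, a, c; b, d, d]`. -/
def TypeL (m a b c d : ℕ) : Prop :=
  1 ≤ a ∧ 1 ≤ b ∧ a < c ∧ b < d ∧ c < m ∧ d < m ∧ a ≠ b ∧ a ≠ d ∧ c ≠ d ∧ b ≠ c

/-- The Morse boundary `μ_2(C_m) → μ_1(C_m)`. -/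
def confBoundary (R : Type*) [CommRing R] (m : ℕ) :=
  FinComplex.morseBoundary R (confComplex m) (confField m) 1

/-- The Morse coboundary `μ^1(C_m) → μ^2(C_m)`. -/
def confCoboundary (R : Type*) [CommRing R] (m : ℕ) :=
  FinComplex.morseCoboundary R (confComplex m) (confField m) 1

/-- The basis element of the Morse chains of `C_m` given by a critical `p`-face. -/
def confCell (R : Type*) [CommRing R] (m p : ℕ) (σ : Finset (ℕ ×ₗ ℕ)) :=
  FinComplex.morseCell R (confComplex m) (confField m) p σ

/-- The basis element of the Morse cochains of `C_m` dual to a critical `p`-face. -/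
def confDual (R : Type*) [CommRing R] (m p : ℕ) (σ : Finset (ℕ ×ₗ ℕ)) :=
  FinComplex.morseDual R (confComplex m) (confField m) p σ

end

/-!
The matching built by the algorithm has a simple closed form, and everything else is read off it.

*The matching.* The algorithm is greedy. Two distinct candidate pairings with a common face differ
in their dimension, in the position of the new vertex or in the new vertex itself, so the order in
which the faces `α` are visited is irrelevant. Hence a matching is the output of the algorithm as
soon as every candidate pairing outside it meets a pairing of higher priority inside it
(`FinComplex.mem_gradientField_iff`). A `2`-face of `C_m` consists of two opposite corners of a
rectangle and one of the other two corners. The matching `ConfPair m` adds to a `1`-face a last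
column which is as large as possible (`PairLast`) or a corner between its two columns
(`PairMiddle`). It adds the last column `[m; m-1]` or `[m-1; m]` to every `0`-face other than these
two (`PairSecond`); the vertex `[m-1; m]` is paired with `[m-1, m-1; m-2, m]`, and `[m; m-1]`
is critical. That it is the output of the algorithm is `mem_confField`.

*Acyclicity.* Every upper path of `1`-faces strictly decreases an explicit rank with values at
most `4` (`edgeRank`), and an upper path of `0`-faces has at most three steps. So upper paths
terminate, there are finitely many of them between two given faces, and the sum of their
multiplicities satisfies a recursion along the first step (`FinComplex.pathSum_of_mem`).

*The boundary.* Fix a critical `1`-face `α` and write `S` for the sum of the multiplicities of the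
upper paths which end in `α`, and `1_e` for the indicator of `e = α`. The recursion gives, for
entries smaller than `m`,

* `S [a, a; b, d] = 1_[m, m; b, d]`,
* `S [a, c; b, b] = 1_[a, m-1; b, m] - 1_[c, m-1; b, m] + 1_[a, c; m, m]`,
* `S [a, c; b, d] = S [a, c; b, b] + S [c, c; b, d]` if `a < c`, `b < d` and `b ≠ c`.

In the alternating sum over the facets of `[a, a, c; b, d, d]` the contributions of `[m, m; b, d]`
and `[a, c; m, m]` cancel, and the four faces `[·, m-1; ·, m]` remain (`finsum_mixedPath_conf`). The
only one of them which may fail to be critical is `[m-1, m-1; m-2, m]`, which accounts for the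
exceptional case of the boundary formula. The statements on the coboundary follow by duality.
-/

open FinComplex

noncomputable section

namespace FinComplex

/-! ### Greedy matchings -/

section Greedy

variable {V : Type}

theorem mem_facesOfDim (K : FinComplex V) (i : ℕ) (α : Finset V) :
    α ∈ K.facesOfDim i ↔ α ∈ K.faceFinset ∧ α.card = i + 1 := by
  simp [facesOfDim]

theorem mem_faceFinset (K : FinComplex V) (α : Finset V) : α ∈ K.faceFinset ↔ α ∈ K.faces := by
  simp [faceFinset]

variable [LinearOrder V]

/-- The position of `v` among the vertices of `β`, counted from `0`. -/
def position (β : Finset V) (v : V) : ℕ := {u ∈ β | u < v}.card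

/-- The instruction `(i, r, v)` has strict priority over `(i', r', v')` in the algorithm. The last
component of an instruction is left out: two distinct candidate pairings which agree in `i`, `r` and
`v` have no face in common. -/
def Precedes (i r : ℕ) (v : V) (i' r' : ℕ) (v' : V) : Prop :=
  i' < i ∨ i = i' ∧ (r' < r ∨ r = r' ∧ v' < v)

theorem pairwise_instructions (K : FinComplex V) :
    K.instructions.Pairwise fun c c' =>
      ¬ Precedes c'.1 c'.2.1 c'.2.2.1 c.1 c.2.1 c.2.2.1 := by
  have hrange : ∀ n, (List.range n).reverse.Pairwise (· > ·) := fun n => by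
    rw [List.pairwise_reverse]; exact List.pairwise_lt_range
  have hvert : K.verticesDescending.Pairwise (· ≥ ·) := by
    rw [verticesDescending, List.pairwise_reverse]
    exact Finset.pairwise_sort _ _
  simp only [instructions, List.pairwise_flatMap, List.pairwise_map, List.mem_flatMap, List.mem_map,
    Precedes]
  refine ⟨fun i _ => ⟨fun r _ => ⟨fun v _ => ?_, ?_⟩, ?_⟩, ?_⟩
  · exact List.pairwise_of_forall (by simp)
  · refine hvert.imp ?_
    rintro v v' h _ ⟨α, -, rfl⟩ _ ⟨α', -, rfl⟩
    simpa using h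
  · refine (hrange _).imp ?_
    rintro r r' h _ ⟨v, -, α, -, rfl⟩ _ ⟨v', -, α', -, rfl⟩
    simp; omega
  · refine (hrange _).imp ?_
    rintro i i' h _ ⟨r, -, v, -, α, -, rfl⟩ _ ⟨r', -, v', -, α', -, rfl⟩
    simp; omega

theorem mem_facesLex (K : FinComplex V) (i : ℕ) (α : Finset V) :
    α ∈ K.facesLex i ↔ α ∈ K.facesOfDim i := by
  simp [facesLex]

theorem mem_instructions (K : FinComplex V) (i r : ℕ) (v : V) (α : Finset V) :
    (i, r, v, α) ∈ K.instructions ↔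
      i < K.dim ∧ r < i + 2 ∧ v ∈ K.vertices ∧ α ∈ K.facesOfDim i := by
  simp [instructions, verticesDescending, mem_facesLex]

theorem position_insert {α : Finset V} {v : V} :
    position (insert v α) v = {u ∈ α | u < v}.card := by
  simp [position, Finset.filter_insert]

/-- Every candidate pairing is the subject of an instruction. -/
theorem exists_instruction (K : FinComplex V) {β : Finset V} {v : V} (hβ : β ∈ K.faceFinset)
    (hv : v ∈ β) (hne : (β.erase v).Nonempty) :
    (β.card - 2, position β v, v, β.erase v) ∈ K.instructions := by
  have hc := Finset.card_erase_of_mem hv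
  have hpos := hne.card_pos
  have hface : β.erase v ∈ K.faceFinset := by
    rw [mem_faceFinset] at hβ ⊢
    exact (K.isRelLowerSet_faces hβ).2 (Finset.erase_subset _ _) hne
  rw [mem_instructions]
  refine ⟨?_, ?_, ?_, ?_⟩
  · have : β.card - 1 ≤ K.dim := Finset.le_sup (f := fun σ : Finset V => σ.card - 1) hβ
    omega
  · have : position β v ≤ (β.erase v).card := by
      refine Finset.card_le_card fun u hu => ?_
      rw [Finset.mem_filter] at hu
      exact Finset.mem_erase.2 ⟨hu.2.ne, hu.1⟩
    omega
  · exact Finset.mem_biUnion.2 ⟨β, hβ, hv⟩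
  · rw [mem_facesOfDim]
    exact ⟨hface, by omega⟩

/-- A matching `P` is the one constructed by the algorithm as soon as every candidate pairing
outside `P` has a face in common with a pairing of `P` of strictly higher priority. -/
theorem mem_gradientField_iff (K : FinComplex V) (P : Finset V → Finset V → Prop)
    (hP : ∀ α β, P α β → β ∈ K.faceFinset ∧ ∃ v ∈ β, α = β.erase v ∧ α.Nonempty)
    (hmatch : ∀ α β α' β', P α β → P α' β' → (α = α' ∨ α = β' ∨ β = α' ∨ β = β') →
      α = α' ∧ β = β')
    (hgreedy : ∀ β ∈ K.faceFinset, ∀ v ∈ β, (β.erase v).Nonempty → ¬ P (β.erase v) β →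
      ∃ β', ∃ v' ∈ β', P (β'.erase v') β' ∧
        (β'.erase v' = β.erase v ∨ β'.erase v' = β ∨ β' = β.erase v ∨ β' = β) ∧
        Precedes (β'.card - 2) (position β' v') v' (β.card - 2) (position β v) v)
    (e : Finset V × Finset V) : e ∈ K.gradientField ↔ P e.1 e.2 := by
  -- After any initial segment `l` of the instructions, the pairings constructed are those of `P`
  -- whose instruction is in `l`.
  have key : ∀ l, l <+: K.instructions →
      (∀ e, e ∈ (l.foldl K.step (∅, K.faceFinset)).1 ↔ P e.1 e.2 ∧
        ∃ v ∈ e.2, e.1 = e.2.erase v ∧ (e.2.card - 2, position e.2 v, v, e.1) ∈ l) ∧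
      (∀ σ, σ ∈ (l.foldl K.step (∅, K.faceFinset)).2 ↔ σ ∈ K.faceFinset ∧
        ∀ e ∈ (l.foldl K.step (∅, K.faceFinset)).1, e.1 ≠ σ ∧ e.2 ≠ σ) := by
    intro l
    induction l using List.reverseRecOn with
    | nil => simp
    | append_singleton l c ih =>
      intro hl
      obtain ⟨ih1, ih2⟩ := ih ((List.prefix_append l [c]).trans hl)
      rw [List.foldl_append]
      set s := l.foldl K.step (∅, K.faceFinset) with hs
      obtain ⟨i, r, v, α⟩ := c
      have hc : (i, r, v, α) ∈ K.instructions := hl.subset (by simp)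
      obtain ⟨-, -, -, hα⟩ := (mem_instructions _ _ _ _ _).1 hc
      rw [mem_facesOfDim] at hα
      have hlate : ∀ c' ∈ K.instructions, Precedes c'.1 c'.2.1 c'.2.2.1 i r v → c' ∈ l := by
        obtain ⟨t, ht⟩ := hl
        intro c' hc' hpre
        have hpw := K.pairwise_instructions
        rw [← ht, List.append_assoc, List.pairwise_append] at hpw
        rw [← ht, List.append_assoc, List.mem_append] at hc'
        rcases hc' with h | h
        · exact h
        · exfalso
          rcases List.mem_cons.1 h with rfl | h
          · simp [Precedes] at hpre
          · exact (List.pairwise_cons.1 hpw.2.1).1 c' h hpre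
      by_cases hcand : insert v α ∈ K.facesOfDim (i + 1) ∧ {u ∈ α | u < v}.card = r
      · obtain ⟨hβ, hr⟩ := hcand
        rw [mem_facesOfDim] at hβ
        have hv : v ∉ α := fun h => by
          rw [Finset.insert_eq_of_mem h] at hβ; omega
        have hne : α.Nonempty := Finset.card_pos.1 (by omega)
        have herase : (insert v α).erase v = α := Finset.erase_insert hv
        have hr' : position (insert v α) v = r := by rw [position_insert, hr]
        have hcard : (insert v α).card - 2 = i := by omega
        by_cases hmem : P α (insert v α)
        · by_cases hold : (α, insert v α) ∈ s.1
          · -- the pairing has been added before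
            have hstep : K.step s (i, r, v, α) = s := by
              have : α ∉ s.2 := fun h => ((ih2 α).1 h).2 _ hold |>.1 rfl
              simp [step, this]
            simp only [List.foldl_cons, List.foldl_nil, hstep]
            refine ⟨fun e => ?_, ih2⟩
            rw [ih1]
            constructor
            · rintro ⟨h, w, hw, h1, h2⟩
              exact ⟨h, w, hw, h1, by simp [h2]⟩
            · rintro ⟨h, w, hw, h1, h2⟩
              rcases List.mem_append.1 h2 with h2 | h2
              · exact ⟨h, w, hw, h1, h2⟩
              · simp only [List.mem_singleton, Prod.mk.injEq] at h2
                obtain ⟨-, -, rfl, h3⟩ := h2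
                have : e = (α, insert w α) := by
                  have h4 : e.2 = insert w α := by rw [← h3, h1, Finset.insert_erase hw]
                  exact Prod.ext h3 h4
                rw [← this, ih1] at hold
                exact hold
          · have hfree : ∀ e ∈ s.1, e.1 ≠ α ∧ e.2 ≠ α ∧ e.1 ≠ insert v α ∧ e.2 ≠ insert v α := by
              intro e he
              have hPe := ((ih1 e).1 he).1
              have aux : (α = e.1 ∨ α = e.2 ∨ insert v α = e.1 ∨ insert v α = e.2) → False := by
                intro h
                obtain ⟨h1, h2⟩ := hmatch _ _ _ _ hmem hPe h
                apply hold
                rwa [show (α, insert v α) = e from Prod.ext h1 h2]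
              refine ⟨fun h => aux ?_, fun h => aux ?_, fun h => aux ?_, fun h => aux ?_⟩ <;>
                simp [h]
            have hstep : K.step s (i, r, v, α) =
                (insert (α, insert v α) s.1, (s.2.erase α).erase (insert v α)) := by
              simp only [step]
              rw [if_pos]
              refine ⟨(mem_facesOfDim _ _ _).2 hβ, hr, (ih2 _).2 ⟨hα.1, fun e he => ?_⟩,
                (ih2 _).2 ⟨hβ.1, fun e he => ?_⟩⟩
              · exact ⟨(hfree e he).1, (hfree e he).2.1⟩
              · exact (hfree e he).2.2
            simp only [List.foldl_cons, List.foldl_nil, hstep]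
            refine ⟨fun e => ?_, fun σ => ?_⟩
            · rw [Finset.mem_insert, ih1]
              constructor
              · rintro (rfl | ⟨h, w, hw, h1, h2⟩)
                · exact ⟨hmem, v, by simp, herase.symm, by simp [hcard, hr']⟩
                · exact ⟨h, w, hw, h1, by simp [h2]⟩
              · rintro ⟨h, w, hw, h1, h2⟩
                rcases List.mem_append.1 h2 with h2 | h2
                · exact Or.inr ⟨h, w, hw, h1, h2⟩
                · simp only [List.mem_singleton, Prod.mk.injEq] at h2
                  obtain ⟨-, -, rfl, h3⟩ := h2
                  left
                  have h4 : e.2 = insert w α := by rw [← h3, h1, Finset.insert_erase hw]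
                  exact Prod.ext h3 h4
            · simp only [Finset.mem_erase, ih2, Finset.mem_insert, forall_eq_or_imp]
              tauto
        · -- a pairing of higher priority blocks the instruction
          have hstep : K.step s (i, r, v, α) = s := by
            simp only [step]
            rw [if_neg]
            rintro ⟨-, -, h1, h2⟩
            obtain ⟨β', v', hv', hP', hshare, hpre⟩ := hgreedy (insert v α) hβ.1 v (by simp)
              (by rwa [herase]) (by rwa [herase])
            rw [herase] at hshare
            rw [hcard, hr'] at hpre
            obtain ⟨hβ', w, hw, hw', hne'⟩ := hP _ _ hP'
            have hin := hlate _ (K.exists_instruction hβ' hv' hne') hpre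
            have hs1 : (β'.erase v', β') ∈ s.1 := (ih1 _).2 ⟨hP', v', hv', rfl, hin⟩
            have a1 := ((ih2 _).1 h1).2 _ hs1
            have a2 := ((ih2 _).1 h2).2 _ hs1
            simp only at a1 a2
            tauto
          simp only [List.foldl_cons, List.foldl_nil, hstep]
          refine ⟨fun e => ?_, ih2⟩
          rw [ih1]
          constructor
          · rintro ⟨h, w, hw, h1, h2⟩
            exact ⟨h, w, hw, h1, by simp [h2]⟩
          · rintro ⟨h, w, hw, h1, h2⟩
            rcases List.mem_append.1 h2 with h2 | h2
            · exact ⟨h, w, hw, h1, h2⟩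
            · simp only [List.mem_singleton, Prod.mk.injEq] at h2
              obtain ⟨-, -, rfl, h3⟩ := h2
              have h4 : e.2 = insert w α := by rw [← h3, h1, Finset.insert_erase hw]
              rw [h3, h4] at h
              exact absurd h hmem
      · -- the instruction does not describe a candidate pairing
        have hstep : K.step s (i, r, v, α) = s := by
          simp only [step]
          rw [if_neg]
          tauto
        simp only [List.foldl_cons, List.foldl_nil, hstep]
        refine ⟨fun e => ?_, ih2⟩
        rw [ih1]
        constructor
        · rintro ⟨h, w, hw, h1, h2⟩
          exact ⟨h, w, hw, h1, by simp [h2]⟩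
        · rintro ⟨h, w, hw, h1, h2⟩
          rcases List.mem_append.1 h2 with h2 | h2
          · exact ⟨h, w, hw, h1, h2⟩
          · exfalso
            simp only [List.mem_singleton, Prod.mk.injEq] at h2
            obtain ⟨h5, h6, rfl, h3⟩ := h2
            have h4 : insert w α = e.2 := by rw [← h3, h1, Finset.insert_erase hw]
            apply hcand
            have hcd := Finset.card_erase_of_mem hw
            rw [← h1, h3, hα.2] at hcd
            refine ⟨?_, by rw [← position_insert, h4, h6]⟩
            rw [h4, mem_facesOfDim]
            exact ⟨(hP _ _ h).1, by omega⟩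
  have := (key _ (List.prefix_refl _)).1 e
  rw [gradientField, this]
  refine ⟨fun h => h.1, fun h => ⟨h, ?_⟩⟩
  obtain ⟨hβ, v, hv, h1, hne⟩ := hP _ _ h
  refine ⟨v, hv, h1, ?_⟩
  rw [h1] at hne ⊢
  exact K.exists_instruction hβ hv hne

end Greedy

end FinComplex

namespace FinComplex

/-! ### Sums over gradient paths -/

section PathSums

variable {V : Type} {K : FinComplex V} {W : Finset (Finset V × Finset V)}

/-- An elementary upper path `α ↗ β ↘ γ`. -/
def UpStep (K : FinComplex V) (W : Finset (Finset V × Finset V)) (α γ : Finset V) : Prop :=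
  ∃ β, (α, β) ∈ W ∧ DownEdge K W β γ

/-- An upper path is either constant or an elementary path followed by an upper path. -/
def upperPathEquiv (K : FinComplex V) (W : Finset (Finset V × Finset V)) (γ α : Finset V) :
    UpperPath K W γ α ≃ PLift (γ = α) ⊕
      (Σ x : {x : Finset V × Finset V // (γ, x.1) ∈ W ∧ DownEdge K W x.1 x.2},
        UpperPath K W x.1.2 α) where
  toFun l := match l with
    | .const _ => .inl ⟨rfl⟩
    | .cons (β₁ := β) (α₁ := δ) up down tail => .inr ⟨⟨(β, δ), up, down⟩, tail⟩
  invFun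
    | .inl h => h.down ▸ .const γ
    | .inr ⟨x, tail⟩ => .cons x.2.1 x.2.2 tail
  left_inv l := by cases l <;> rfl
  right_inv
    | .inl ⟨h⟩ => by subst h; rfl
    | .inr ⟨x, tail⟩ => rfl

/-- A mixed path is a downward edge followed by an upper path. -/
def mixedPathEquiv (K : FinComplex V) (W : Finset (Finset V × Finset V)) (β α : Finset V) :
    MixedPath K W β α ≃ Σ x : {x : Finset V // DownEdge K W β x}, UpperPath K W x.1 α where
  toFun l := ⟨⟨l.mid, l.down⟩, l.upper⟩
  invFun x := ⟨x.1.1, x.1.2, x.2⟩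
  left_inv _ := rfl
  right_inv _ := rfl

instance finite_downEdge (β : Finset V) : Finite {x : Finset V // DownEdge K W β x} :=
  (K.faceFinset.finite_toSet.subset fun _ hx => hx.2.1).to_subtype

instance finite_upStep (γ : Finset V) :
    Finite {x : Finset V × Finset V // (γ, x.1) ∈ W ∧ DownEdge K W x.1 x.2} :=
  ((K.faceFinset ×ˢ K.faceFinset).finite_toSet.subset fun _ hx =>
    Finset.mem_coe.2 (Finset.mem_product.2 ⟨hx.2.1, hx.2.2.1⟩)).to_subtype

theorem finite_upperPath {γ : Finset V} (h : Acc (fun δ γ => UpStep K W γ δ) γ) (α : Finset V) :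
    Finite (UpperPath K W γ α) := by
  induction h with
  | intro γ _ ih =>
    have : ∀ x : {x : Finset V × Finset V // (γ, x.1) ∈ W ∧ DownEdge K W x.1 x.2},
        Finite (UpperPath K W x.1.2 α) := fun x => ih _ ⟨x.1.1, x.2⟩
    exact Finite.of_equiv _ (upperPathEquiv K W γ α).symm

/-- Without infinite upper paths there are no cyclic ones. -/
theorem not_transGen_of_wellFounded (h : ∀ γ, Acc (fun δ γ => UpStep K W γ δ) γ) (α : Finset V) :
    ¬ Relation.TransGen (UpStep K W) α α := by
  intro hα
  have hwf : WellFounded (fun δ γ => UpStep K W γ δ) := ⟨h⟩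
  exact hwf.transGen.irrefl.irrefl α (Relation.transGen_swap.1 hα)

variable [LinearOrder V]

/-- The sum of the multiplicities of all upper paths from `γ` to `α`. -/
def pathSum (K : FinComplex V) (W : Finset (Finset V × Finset V)) (γ α : Finset V) : ℤ :=
  ∑ᶠ l : UpperPath K W γ α, l.mult

theorem incidence_erase {β : Finset V} {v : V} (hv : v ∈ β) :
    incidence (β.erase v) β = (-1) ^ position β v := by
  rw [incidence, Finset.sum_eq_single v]
  · simp [position]
  · intro w hw hne
    rw [if_neg]
    exact fun h => hne (Finset.erase_injOn β hw hv h)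
  · exact fun h => absurd hv h

theorem downEdge_iff {β δ : Finset V} (hβ : β ∈ K.faceFinset) (hc : 2 ≤ β.card) :
    DownEdge K W β δ ↔ (∃ v ∈ β, β.erase v = δ) ∧ (δ, β) ∉ W := by
  constructor
  · rintro ⟨-, -, hs, hcard, hW⟩
    have h1 : (β \ δ).card = 1 := by rw [Finset.card_sdiff_of_subset hs]; omega
    obtain ⟨v, hv⟩ := Finset.card_eq_one.1 h1
    have hvm : v ∈ β \ δ := by simp [hv]
    refine ⟨⟨v, (Finset.mem_sdiff.1 hvm).1, ?_⟩, hW⟩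
    rw [Finset.erase_eq, ← hv, Finset.sdiff_sdiff_eq_self hs]
  · rintro ⟨⟨v, hv, rfl⟩, hW⟩
    have hcard := Finset.card_erase_of_mem hv
    refine ⟨hβ, ?_, Finset.erase_subset _ _, by omega, hW⟩
    rw [mem_faceFinset] at hβ ⊢
    exact (K.isRelLowerSet_faces hβ).2 (Finset.erase_subset _ _)
      (Finset.card_pos.1 (by omega))

/-- The upper paths from a face which is not paired upwards are constant. -/
theorem pathSum_of_forall_notMem {γ : Finset V} (h : ∀ β, (γ, β) ∉ W) (α : Finset V) :
    pathSum K W γ α = if γ = α then 1 else 0 := by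
  classical
  have : IsEmpty (Σ x : {x : Finset V × Finset V // (γ, x.1) ∈ W ∧ DownEdge K W x.1 x.2},
      UpperPath K W x.1.2 α) := ⟨fun x => h _ x.1.2.1⟩
  have : Subsingleton (UpperPath K W γ α) :=
    ((upperPathEquiv K W γ α).trans (Equiv.sumEmpty _ _)).subsingleton
  rw [pathSum]
  split_ifs with hγ
  · subst hγ
    rw [finsum_eq_single _ (UpperPath.const γ) fun l hl => absurd (Subsingleton.elim _ _) hl]
    rfl
  · have : IsEmpty (UpperPath K W γ α) :=
      ⟨fun l => hγ ((upperPathEquiv K W γ α).trans (Equiv.sumEmpty _ _) l).down⟩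
    exact finsum_of_isEmpty _

/-- Upper paths from `γ` sorted by their first step, which goes through the partner `β` of `γ`. -/
theorem pathSum_of_mem (hW : K.IsGradientField W)
    (hacc : ∀ γ, Acc (fun δ γ => UpStep K W γ δ) γ) {γ β : Finset V} (h : (γ, β) ∈ W)
    (α : Finset V) :
    pathSum K W γ α = (if γ = α then 1 else 0) - incidence γ β *
      ∑ v ∈ β, if β.erase v = γ then 0 else (-1) ^ position β v * pathSum K W (β.erase v) α := by
  classical
  obtain ⟨hγf, hβf, hs, hcard⟩ := hW.facet _ h
  have hγne : γ.Nonempty := (K.isRelLowerSet_faces ((mem_faceFinset _ _).1 hγf)).1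
  have hc2 : 2 ≤ β.card := by have := hγne.card_pos; simp only at hcard; omega
  have := fun γ => finite_upperPath (hacc γ) α
  have := fun γ => Fintype.ofFinite (UpperPath K W γ α)
  have := Fintype.ofFinite {x : Finset V × Finset V // (γ, x.1) ∈ W ∧ DownEdge K W x.1 x.2}
  have hsum : ∀ γ, pathSum K W γ α = ∑ l : UpperPath K W γ α, l.mult := fun γ =>
    finsum_eq_sum_of_fintype _
  rw [hsum γ, ← Equiv.sum_comp (upperPathEquiv K W γ α).symm, Fintype.sum_sum_type,
    Fintype.sum_sigma, sub_eq_add_neg]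
  congr 1
  · split_ifs with hγ
    · subst hγ
      rw [Fintype.sum_eq_single ⟨rfl⟩ fun x hx => absurd (Subsingleton.elim _ _) hx]
      rfl
    · have : IsEmpty (PLift (γ = α)) := ⟨fun x => hγ x.down⟩
      simp
  · have hterm : ∀ x : {x : Finset V × Finset V // (γ, x.1) ∈ W ∧ DownEdge K W x.1 x.2},
        ∑ l : UpperPath K W x.1.2 α, ((upperPathEquiv K W γ α).symm (.inr ⟨x, l⟩)).mult =
          -(incidence γ x.1.1 * incidence x.1.2 x.1.1) * pathSum K W x.1.2 α := by
      intro x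
      rw [hsum, Finset.mul_sum]
      rfl
    rw [Finset.sum_congr rfl fun x _ => hterm x,
      ← Finset.sum_subtype (((β.image β.erase).filter (· ≠ γ)).image fun δ => (β, δ))
        (f := fun x : Finset V × Finset V =>
          -(incidence γ x.1 * incidence x.2 x.1) * pathSum K W x.2 α)]
    · rw [Finset.sum_image (by simp), Finset.sum_filter,
        Finset.sum_image (Finset.erase_injOn β), ← neg_mul, Finset.mul_sum]
      refine Finset.sum_congr rfl fun v hv => ?_
      by_cases hvγ : β.erase v = γ
      · simp [hvγ]
      · rw [if_pos hvγ, if_neg hvγ, incidence_erase hv]; ring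
    · rintro ⟨β', δ⟩
      simp only [Finset.mem_image, Finset.mem_filter, Prod.mk.injEq, exists_eq_right_right]
      constructor
      · rintro ⟨⟨hv, hne⟩, rfl⟩
        refine ⟨h, (downEdge_iff hβf hc2).2 ⟨hv, fun hδ => hne ?_⟩⟩
        exact congrArg Prod.fst (hW.matching _ hδ _ h (by simp))
      · rintro ⟨hγ, hd⟩
        obtain rfl : β = β' := congrArg Prod.snd (hW.matching _ h _ hγ (by simp))
        obtain ⟨hv, hδ⟩ := (downEdge_iff hβf hc2).1 hd
        exact ⟨⟨hv, fun h' => hδ (h' ▸ h)⟩, rfl⟩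

/-- Mixed paths from a face `β` which is not paired downwards, sorted by their first edge. -/
theorem finsum_mixedPath (hacc : ∀ γ, Acc (fun δ γ => UpStep K W γ δ) γ) {β : Finset V}
    (hβ : β ∈ K.faceFinset) (hc : 2 ≤ β.card) (hcrit : ∀ δ, (δ, β) ∉ W) (α : Finset V) :
    ∑ᶠ l : MixedPath K W β α, l.mult =
      ∑ v ∈ β, (-1) ^ position β v * pathSum K W (β.erase v) α := by
  classical
  have := fun γ => finite_upperPath (hacc γ) α
  have := fun γ => Fintype.ofFinite (UpperPath K W γ α)
  have := Fintype.ofFinite {x : Finset V // DownEdge K W β x}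
  have := Fintype.ofEquiv _ (mixedPathEquiv K W β α).symm
  have hsum : ∀ γ, pathSum K W γ α = ∑ l : UpperPath K W γ α, l.mult := fun γ =>
    finsum_eq_sum_of_fintype _
  rw [finsum_eq_sum_of_fintype, ← Equiv.sum_comp (mixedPathEquiv K W β α).symm,
    Fintype.sum_sigma]
  have hterm : ∀ x : {x : Finset V // DownEdge K W β x},
      ∑ l : UpperPath K W x.1 α, ((mixedPathEquiv K W β α).symm ⟨x, l⟩).mult =
        incidence x.1 β * pathSum K W x.1 α := by
    intro x
    rw [hsum, Finset.mul_sum]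
    rfl
  rw [Finset.sum_congr rfl fun x _ => hterm x,
    ← Finset.sum_subtype (β.image β.erase) (f := fun x => incidence x β * pathSum K W x α)]
  · rw [Finset.sum_image (Finset.erase_injOn β)]
    exact Finset.sum_congr rfl fun v hv => by rw [incidence_erase hv]
  · intro δ
    rw [downEdge_iff hβ hc, Finset.mem_image]
    exact ⟨fun h => ⟨h, hcrit δ⟩, fun h => h.1⟩

end PathSums

end FinComplex

namespace FinComplex

/-! ### Faces with at most three vertices -/

section SmallFaces

variable {V : Type} [LinearOrder V] {p q s p' q' s' : V}

theorem card_pair_of_lt (h : p < q) : ({p, q} : Finset V).card = 2 := Finset.card_pair h.ne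

theorem card_triple_of_lt (h : p < q) (h' : q < s) : ({p, q, s} : Finset V).card = 3 :=
  Finset.card_eq_three.2 ⟨p, q, s, h.ne, (h.trans h').ne, h'.ne, rfl⟩

theorem erase_pair_left (h : p < q) : ({p, q} : Finset V).erase p = {q} :=
  Finset.erase_insert (by simp [h.ne])

theorem erase_pair_right (h : p < q) : ({p, q} : Finset V).erase q = {p} := by
  rw [Finset.pair_comm, Finset.erase_insert (by simp [h.ne'])]

theorem erase_triple_left (h : p < q) (h' : q < s) :
    ({p, q, s} : Finset V).erase p = {q, s} :=
  Finset.erase_insert (by simp [h.ne, (h.trans h').ne])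

theorem erase_triple_middle (h : p < q) (h' : q < s) :
    ({p, q, s} : Finset V).erase q = {p, s} := by
  rw [Finset.insert_comm, Finset.erase_insert (by simp [h.ne', h'.ne])]

theorem erase_triple_right (h : p < q) (h' : q < s) :
    ({p, q, s} : Finset V).erase s = {p, q} := by
  rw [show ({p, q, s} : Finset V) = {s, p, q} by ext; simp; tauto,
    Finset.erase_insert (by simp [h'.ne', (h.trans h').ne'])]

theorem position_pair_left (h : p < q) : position {p, q} p = 0 := by
  simp [position, Finset.filter_insert, Finset.filter_singleton, h.not_gt]

theorem position_pair_right (h : p < q) : position {p, q} q = 1 := by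
  simp [position, Finset.filter_insert, Finset.filter_singleton, h]

theorem position_triple_left (h : p < q) (h' : q < s) : position {p, q, s} p = 0 := by
  simp [position, Finset.filter_insert, Finset.filter_singleton, h.not_gt, (h.trans h').not_gt]

theorem position_triple_middle (h : p < q) (h' : q < s) : position {p, q, s} q = 1 := by
  simp [position, Finset.filter_insert, Finset.filter_singleton, h, h'.not_gt]

theorem position_triple_right (h : p < q) (h' : q < s) : position {p, q, s} s = 2 := by
  simp [position, Finset.filter_insert, Finset.filter_singleton, h.trans h', h', h.ne]

theorem pair_inj_of_lt (h : p < q) (h' : p' < q') :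
    ({p, q} : Finset V) = {p', q'} ↔ p = p' ∧ q = q' := by
  constructor
  · intro e
    have h1 : p ∈ ({p', q'} : Finset V) := by simp [← e]
    have h2 : q ∈ ({p', q'} : Finset V) := by simp [← e]
    simp only [Finset.mem_insert, Finset.mem_singleton] at h1 h2
    rcases h1 with rfl | rfl <;> rcases h2 with rfl | rfl
    · exact absurd h (lt_irrefl _)
    · exact ⟨rfl, rfl⟩
    · exact absurd h h'.not_gt
    · exact absurd h (lt_irrefl _)
  · rintro ⟨rfl, rfl⟩; rfl

theorem triple_inj_of_lt (h : p < q) (h1 : q < s) (h' : p' < q') (h1' : q' < s') :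
    ({p, q, s} : Finset V) = {p', q', s'} ↔ p = p' ∧ q = q' ∧ s = s' := by
  constructor
  · intro e
    have hp : p = p' := by
      have a1 : p ∈ ({p', q', s'} : Finset V) := by simp [← e]
      have a2 : p' ∈ ({p, q, s} : Finset V) := by simp [e]
      simp only [Finset.mem_insert, Finset.mem_singleton] at a1 a2
      refine le_antisymm ?_ ?_
      · rcases a2 with rfl | rfl | rfl
        exacts [le_rfl, h.le, (h.trans h1).le]
      · rcases a1 with rfl | rfl | rfl
        exacts [le_rfl, h'.le, (h'.trans h1').le]
    subst hp
    have e' := congrArg (fun σ => Finset.erase σ p) e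
    simp only [erase_triple_left h h1, erase_triple_left h' h1', pair_inj_of_lt h1 h1'] at e'
    exact ⟨rfl, e'⟩
  · rintro ⟨rfl, rfl, rfl⟩; rfl

end SmallFaces

end FinComplex

/-! ### The faces of the configuration complex -/

/-- The column with entries `a` and `b`, as a vertex of the ordered square. -/
def col (a b : ℕ) : ℕ ×ₗ ℕ := toLex (a, b)

theorem col_lt {a b c d : ℕ} : col a b < col c d ↔ a < c ∨ a = c ∧ b < d :=
  Prod.Lex.toLex_lt_toLex

theorem col_inj {a b c d : ℕ} : col a b = col c d ↔ a = c ∧ b = d := by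
  simp [col]

/-- The column with entries `a` and `b` is a vertex of `C_m`. -/
def IsVertex (m a b : ℕ) : Prop := 1 ≤ a ∧ 1 ≤ b ∧ a ≤ m ∧ b ≤ m ∧ a ≠ b

/-- The matrix `[a, c; b, d]` is a `1`-face of `C_m`. -/
def IsEdge (m a b c d : ℕ) : Prop :=
  1 ≤ a ∧ 1 ≤ b ∧ a ≤ c ∧ b ≤ d ∧ c ≤ m ∧ d ≤ m ∧ a ≠ b ∧ c ≠ d ∧ (a ≠ c ∨ b ≠ d)

/-- The matrix `[a, e, c; b, f, d]` is a `2`-face of `C_m`. The middle column is one of the two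
remaining corners of the rectangle spanned by the outer ones. -/
def IsTriangle (m a b e f c d : ℕ) : Prop :=
  1 ≤ a ∧ 1 ≤ b ∧ a < c ∧ b < d ∧ c ≤ m ∧ d ≤ m ∧ a ≠ b ∧ c ≠ d ∧ e ≠ f ∧
    (e = a ∧ f = d ∨ e = c ∧ f = b)

section

variable {m a b c d e f : ℕ}

theorem IsEdge.lt (h : IsEdge m a b c d) : col a b < col c d := by
  unfold IsEdge at h; rw [col_lt]; omega

theorem IsTriangle.mk_left (h1 : 1 ≤ a) (h2 : 1 ≤ b) (h3 : a < c) (h4 : b < d) (h5 : c ≤ m)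
    (h6 : d ≤ m) (h7 : a ≠ b) (h8 : c ≠ d) (h9 : a ≠ d) : IsTriangle m a b a d c d :=
  ⟨h1, h2, h3, h4, h5, h6, h7, h8, h9, Or.inl ⟨rfl, rfl⟩⟩

theorem IsTriangle.mk_right (h1 : 1 ≤ a) (h2 : 1 ≤ b) (h3 : a < c) (h4 : b < d) (h5 : c ≤ m)
    (h6 : d ≤ m) (h7 : a ≠ b) (h8 : c ≠ d) (h9 : c ≠ b) : IsTriangle m a b c b c d :=
  ⟨h1, h2, h3, h4, h5, h6, h7, h8, h9, Or.inr ⟨rfl, rfl⟩⟩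

theorem IsTriangle.lt (h : IsTriangle m a b e f c d) :
    col a b < col e f ∧ col e f < col c d := by
  unfold IsTriangle at h; rw [col_lt, col_lt]; omega

theorem mem_completeGraph (σ : Finset ℕ) : σ ∈ (FinComplex.completeGraph m).faces ↔
    σ.Nonempty ∧ σ ⊆ Finset.Icc 1 m ∧ σ.card ≤ 2 := Iff.rfl

theorem mem_confComplex (σ : Finset (ℕ ×ₗ ℕ)) : σ ∈ (confComplex m).faceFinset ↔
    (∃ a b, IsVertex m a b ∧ σ = {col a b}) ∨
    (∃ a b c d, IsEdge m a b c d ∧ σ = {col a b, col c d}) ∨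
    (∃ a b e f c d, IsTriangle m a b e f c d ∧ σ = {col a b, col e f, col c d}) := by
  rw [mem_faceFinset]
  constructor
  · rintro ⟨⟨hne, hchain, ⟨-, h1s, h1c⟩, ⟨-, h2s, h2c⟩⟩, hdiag⟩
    set p := σ.min' hne with hp
    set s := σ.max' hne with hs
    have hpσ : p ∈ σ := σ.min'_mem hne
    have hsσ : s ∈ σ := σ.max'_mem hne
    obtain ⟨a, b, hab⟩ : ∃ a b, p = col a b := ⟨_, _, rfl⟩
    obtain ⟨c, d, hcd⟩ : ∃ c d, s = col c d := ⟨_, _, rfl⟩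
    rw [hab] at hpσ
    rw [hcd] at hsσ
    have hcmp : ∀ x y z w, col x y ∈ σ → col z w ∈ σ → (x ≤ z ∧ y ≤ w) ∨ (z ≤ x ∧ w ≤ y) := by
      intro x y z w hx hz
      have := hchain.total hx hz
      simpa [col] using this
    have hbd : ∀ x y, col x y ∈ σ → 1 ≤ x ∧ x ≤ m ∧ 1 ≤ y ∧ y ≤ m ∧ x ≠ y := by
      intro x y hx
      have g1 := Finset.mem_Icc.1 (h1s (Finset.mem_image_of_mem _ hx))
      have g2 := Finset.mem_Icc.1 (h2s (Finset.mem_image_of_mem _ hx))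
      have g3 := hdiag _ hx
      simp only [col, ofLex_toLex] at g1 g2 g3
      exact ⟨g1.1, g1.2, g2.1, g2.2, g3⟩
    have hbetween : ∀ x y, col x y ∈ σ → a ≤ x ∧ x ≤ c ∧ b ≤ y ∧ y ≤ d := by
      intro x y hx
      have g1 := σ.min'_le _ hx
      have g2 := σ.le_max' _ hx
      rw [← hp, hab, ← not_lt, col_lt] at g1
      rw [← hs, hcd, ← not_lt, col_lt] at g2
      have g3 := hcmp _ _ _ _ hx hpσ
      have g4 := hcmp _ _ _ _ hx hsσ
      omega
    have hcorner : ∀ x y, col x y ∈ σ → (x = a ∨ x = c) ∧ (y = b ∨ y = d) := by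
      intro x y hx
      have g := hbetween x y hx
      constructor
      · by_contra! hcon
        have : ({a, x, c} : Finset ℕ).card ≤ 2 := (Finset.card_le_card (by
          intro z hz
          simp only [Finset.mem_insert, Finset.mem_singleton] at hz
          rcases hz with rfl | rfl | rfl
          exacts [Finset.mem_image_of_mem _ hpσ, Finset.mem_image_of_mem _ hx,
            Finset.mem_image_of_mem _ hsσ])).trans h1c
        rw [card_triple_of_lt (by omega) (by omega)] at this
        omega
      · by_contra! hcon
        have : ({b, y, d} : Finset ℕ).card ≤ 2 := (Finset.card_le_card (by
          intro z hz
          simp only [Finset.mem_insert, Finset.mem_singleton] at hz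
          rcases hz with rfl | rfl | rfl
          exacts [Finset.mem_image_of_mem _ hpσ, Finset.mem_image_of_mem _ hx,
            Finset.mem_image_of_mem _ hsσ])).trans h2c
        rw [card_triple_of_lt (by omega) (by omega)] at this
        omega
    have hcorners : ∀ z ∈ σ, z = col a b ∨ z = col a d ∨ z = col c b ∨ z = col c d := by
      intro z hz
      obtain ⟨x, y, rfl⟩ : ∃ x y, z = col x y := ⟨_, _, rfl⟩
      have := hcorner x y hz
      simp only [col_inj]
      omega
    have g1 := hbd _ _ hpσ
    have g2 := hbd _ _ hsσ
    have g3 := hbetween _ _ hpσ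
    by_cases h1 : a = c ∧ b = d
    · left
      refine ⟨a, b, by unfold IsVertex; omega, ?_⟩
      obtain ⟨rfl, rfl⟩ := h1
      ext z
      rw [Finset.mem_singleton]
      exact ⟨fun hz => by simpa using hcorners z hz, fun hz => hz ▸ hpσ⟩
    right
    by_cases h2 : a ≠ c ∧ b ≠ d ∧ col a d ∈ σ
    · right
      have g4 := hbd _ _ h2.2.2
      refine ⟨a, b, a, d, c, d, by unfold IsTriangle; omega, ?_⟩
      have h3 : col c b ∉ σ := fun h => by
        have := hcmp _ _ _ _ h h2.2.2; omega
      ext z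
      simp only [Finset.mem_insert, Finset.mem_singleton]
      constructor
      · intro hz
        rcases hcorners z hz with h | h | h | h
        · exact Or.inl h
        · exact Or.inr (Or.inl h)
        · exact absurd (h ▸ hz) h3
        · exact Or.inr (Or.inr h)
      · rintro (rfl | rfl | rfl)
        exacts [hpσ, h2.2.2, hsσ]
    by_cases h3 : a ≠ c ∧ b ≠ d ∧ col c b ∈ σ
    · right
      have g4 := hbd _ _ h3.2.2
      refine ⟨a, b, c, b, c, d, by unfold IsTriangle; omega, ?_⟩
      have h4 : col a d ∉ σ := fun h => h2 ⟨h3.1, h3.2.1, h⟩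
      ext z
      simp only [Finset.mem_insert, Finset.mem_singleton]
      constructor
      · intro hz
        rcases hcorners z hz with h | h | h | h
        · exact Or.inl h
        · exact absurd (h ▸ hz) h4
        · exact Or.inr (Or.inl h)
        · exact Or.inr (Or.inr h)
      · rintro (rfl | rfl | rfl)
        exacts [hpσ, h3.2.2, hsσ]
    left
    refine ⟨a, b, c, d, by unfold IsEdge; omega, ?_⟩
    ext z
    simp only [Finset.mem_insert, Finset.mem_singleton]
    constructor
    · intro hz
      rcases hcorners z hz with h | h | h | h
      · exact Or.inl h
      · have : a = c ∨ b = d := by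
          by_contra! hcon; exact h2 ⟨hcon.1, hcon.2, h ▸ hz⟩
        rw [h, col_inj, col_inj]; omega
      · have : a = c ∨ b = d := by
          by_contra! hcon; exact h3 ⟨hcon.1, hcon.2, h ▸ hz⟩
        rw [h, col_inj, col_inj]; omega
      · exact Or.inr h
    · rintro (rfl | rfl)
      exacts [hpσ, hsσ]
  · have htri : ∀ a b e f c d : ℕ, 1 ≤ a → 1 ≤ b → a ≤ e → b ≤ f → e ≤ c → f ≤ d → c ≤ m → d ≤ m →
        a ≠ b → e ≠ f → c ≠ d → (e = a ∨ e = c) → (f = b ∨ f = d) →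
        ({col a b, col e f, col c d} : Finset (ℕ ×ₗ ℕ)) ∈ (confComplex m).faces := by
      intro a b e f c d h1 h2 h3 h4 h5 h6 h7 h8 h9 h10 h11 h12 h13
      refine ⟨⟨by simp, ?_, ?_, ?_⟩, ?_⟩
      · rintro x hx y hy -
        simp only [Finset.coe_insert, Finset.coe_singleton, Set.mem_insert_iff,
          Set.mem_singleton_iff] at hx hy
        rcases hx with rfl | rfl | rfl <;> rcases hy with rfl | rfl | rfl <;>
          simp only [col, ofLex_toLex, Prod.mk_le_mk] <;> omega
      · simp only [Finset.image_insert, Finset.image_singleton, col, ofLex_toLex]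
        refine (mem_completeGraph _).2 ⟨by simp, ?_, ?_⟩
        · intro z hz
          simp only [Finset.mem_insert, Finset.mem_singleton] at hz
          rw [Finset.mem_Icc]; omega
        · refine (Finset.card_le_card (t := {a, c}) ?_).trans Finset.card_le_two
          intro z hz
          simp only [Finset.mem_insert, Finset.mem_singleton] at hz ⊢
          omega
      · simp only [Finset.image_insert, Finset.image_singleton, col, ofLex_toLex]
        refine (mem_completeGraph _).2 ⟨by simp, ?_, ?_⟩
        · intro z hz
          simp only [Finset.mem_insert, Finset.mem_singleton] at hz
          rw [Finset.mem_Icc]; omega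
        · refine (Finset.card_le_card (t := {b, d}) ?_).trans Finset.card_le_two
          intro z hz
          simp only [Finset.mem_insert, Finset.mem_singleton] at hz ⊢
          omega
      · intro x hx
        simp only [Finset.mem_insert, Finset.mem_singleton] at hx
        rcases hx with rfl | rfl | rfl <;> simpa [col]
    rintro (⟨a, b, h, rfl⟩ | ⟨a, b, c, d, h, rfl⟩ | ⟨a, b, e, f, c, d, h, rfl⟩)
    · unfold IsVertex at h
      simpa using htri a b a b a b (by omega) (by omega) (by omega) (by omega) (by omega) (by omega)
        (by omega) (by omega) (by omega) (by omega) (by omega) (by omega) (by omega)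
    · unfold IsEdge at h
      simpa using htri a b a b c d (by omega) (by omega) (by omega) (by omega) (by omega) (by omega)
        (by omega) (by omega) (by omega) (by omega) (by omega) (by omega) (by omega)
    · unfold IsTriangle at h
      exact htri a b e f c d (by omega) (by omega) (by omega) (by omega) (by omega) (by omega)
        (by omega) (by omega) (by omega) (by omega) (by omega) (by omega) (by omega)

theorem edge_mem (h : IsEdge m a b c d) : {col a b, col c d} ∈ (confComplex m).faceFinset :=
  (mem_confComplex _).2 (Or.inr (Or.inl ⟨_, _, _, _, h, rfl⟩))

theorem triangle_mem (h : IsTriangle m a b e f c d) :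
    {col a b, col e f, col c d} ∈ (confComplex m).faceFinset :=
  (mem_confComplex _).2 (Or.inr (Or.inr ⟨_, _, _, _, _, _, h, rfl⟩))

end

/-! ### The matching in closed form -/

/-- The `1`-face `[a, e; b, f]` is paired with the `2`-face `[a, e, c; b, f, d]`, which has a new
last column. -/
def PairLast (m a b e f c d : ℕ) : Prop :=
  IsTriangle m a b e f c d ∧
    (e = a ∧ f = d ∧ (c = m ∧ d < m ∨ c = m - 1 ∧ d = m) ∨
      e = c ∧ f = b ∧ (c < m ∧ d = m ∨ c = m ∧ d = m - 1))

/-- The `1`-face `[a, c; b, d]` is paired with the `2`-face `[a, e, c; b, f, d]`, which has a new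
middle column. -/
def PairMiddle (m a b e f c d : ℕ) : Prop :=
  IsTriangle m a b e f c d ∧
    (e = c ∧ f = b ∧ d < m ∧ ¬ (c = m ∧ d = m - 1) ∨
      e = a ∧ f = d ∧ (c = b ∧ d < m ∨ d = m ∧ c < m - 1))

/-- The `0`-face `[a; b]` is paired with the `1`-face `[a, c; b, d]`, which has a new last
column. -/
def PairSecond (m a b c d : ℕ) : Prop :=
  IsEdge m a b c d ∧ (c = m ∧ d = m - 1 ∨ b = m ∧ c = m - 1 ∧ d = m)

/-- The pairings `α ↗ β` of the gradient field `W_m`, in closed form. The last constructor is the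
only pairing in which the new vertex comes first. -/
inductive ConfPair (m : ℕ) : Finset (ℕ ×ₗ ℕ) → Finset (ℕ ×ₗ ℕ) → Prop
  | last {a b e f c d : ℕ} (h : PairLast m a b e f c d) :
      ConfPair m {col a b, col e f} {col a b, col e f, col c d}
  | middle {a b e f c d : ℕ} (h : PairMiddle m a b e f c d) :
      ConfPair m {col a b, col c d} {col a b, col e f, col c d}
  | second {a b c d : ℕ} (h : PairSecond m a b c d) :
      ConfPair m {col a b} {col a b, col c d}
  | first : ConfPair m {col (m - 1) m} {col (m - 1) (m - 2), col (m - 1) m}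

section

variable {m a b c d e f a' b' c' d' e' f' : ℕ}

theorem isEdge_first (hm : 4 ≤ m) : IsEdge m (m - 1) (m - 2) (m - 1) m := by
  unfold IsEdge; omega

theorem ConfPair.facet (hm : 4 ≤ m) {α β : Finset (ℕ ×ₗ ℕ)} (h : ConfPair m α β) :
    β ∈ (confComplex m).faceFinset ∧ ∃ v ∈ β, α = β.erase v ∧ α.Nonempty := by
  cases h with
  | last h =>
    obtain ⟨h1, h2⟩ := h.1.lt
    exact ⟨triangle_mem h.1, _, by simp, (erase_triple_right h1 h2).symm, by simp⟩
  | middle h =>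
    obtain ⟨h1, h2⟩ := h.1.lt
    exact ⟨triangle_mem h.1, _, by simp, (erase_triple_middle h1 h2).symm, by simp⟩
  | second h =>
    exact ⟨edge_mem h.1, _, by simp, (erase_pair_right h.1.lt).symm, by simp⟩
  | first =>
    exact ⟨edge_mem (isEdge_first hm), _, by simp,
      (erase_pair_left (isEdge_first hm).lt).symm, by simp⟩

theorem edge_eq_iff (h : col a b < col c d) (h' : col a' b' < col c' d') :
    ({col a b, col c d} : Finset (ℕ ×ₗ ℕ)) = {col a' b', col c' d'} ↔
      a = a' ∧ b = b' ∧ c = c' ∧ d = d' := by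
  rw [pair_inj_of_lt h h', col_inj, col_inj, and_assoc]

theorem triangle_eq_iff (h : col a b < col e f ∧ col e f < col c d)
    (h' : col a' b' < col e' f' ∧ col e' f' < col c' d') :
    ({col a b, col e f, col c d} : Finset (ℕ ×ₗ ℕ)) = {col a' b', col e' f', col c' d'} ↔
      a = a' ∧ b = b' ∧ e = e' ∧ f = f' ∧ c = c' ∧ d = d' := by
  rw [triple_inj_of_lt h.1 h.2 h'.1 h'.2, col_inj, col_inj, col_inj, and_assoc, and_assoc]

theorem vertex_eq_iff : ({col a b} : Finset (ℕ ×ₗ ℕ)) = {col a' b'} ↔ a = a' ∧ b = b' := by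
  rw [Finset.singleton_inj, col_inj]

theorem PairLast.lt (h : PairLast m a b e f c d) : col a b < col e f ∧ col e f < col c d := h.1.lt

theorem PairMiddle.lt (h : PairMiddle m a b e f c d) :
    col a b < col e f ∧ col e f < col c d := h.1.lt

theorem PairSecond.lt (h : PairSecond m a b c d) : col a b < col c d := h.1.lt

theorem vertex_ne_edge (h' : col a' b' < col c' d') :
    ({col a b} : Finset (ℕ ×ₗ ℕ)) ≠ {col a' b', col c' d'} := fun e => by
  have := congrArg Finset.card e
  rw [card_pair_of_lt h', Finset.card_singleton] at this
  omega

theorem vertex_ne_triangle (h' : col a' b' < col e' f' ∧ col e' f' < col c' d') :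
    ({col a b} : Finset (ℕ ×ₗ ℕ)) ≠ {col a' b', col e' f', col c' d'} := fun e => by
  have := congrArg Finset.card e
  rw [card_triple_of_lt h'.1 h'.2, Finset.card_singleton] at this
  omega

theorem edge_ne_triangle (h : col a b < col c d)
    (h' : col a' b' < col e' f' ∧ col e' f' < col c' d') :
    ({col a b, col c d} : Finset (ℕ ×ₗ ℕ)) ≠ {col a' b', col e' f', col c' d'} := fun e => by
  have := congrArg Finset.card e
  rw [card_triple_of_lt h'.1 h'.2, card_pair_of_lt h] at this
  omega

theorem ConfPair.up_edge (h : col a b < col c d) {β : Finset (ℕ ×ₗ ℕ)}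
    (hp : ConfPair m {col a b, col c d} β) :
    (∃ e f, PairLast m a b c d e f ∧ β = {col a b, col c d, col e f}) ∨
    (∃ e f, PairMiddle m a b e f c d ∧ β = {col a b, col e f, col c d}) := by
  generalize hα : ({col a b, col c d} : Finset (ℕ ×ₗ ℕ)) = α at hp
  cases hp with
  | last hp =>
    obtain ⟨rfl, rfl, rfl, rfl⟩ := (edge_eq_iff h hp.lt.1).1 hα
    exact Or.inl ⟨_, _, hp, rfl⟩
  | middle hp =>
    obtain ⟨rfl, rfl, rfl, rfl⟩ := (edge_eq_iff h (hp.lt.1.trans hp.lt.2)).1 hα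
    exact Or.inr ⟨_, _, hp, rfl⟩
  | second hp => exact absurd hα.symm (vertex_ne_edge h)
  | first => exact absurd hα.symm (vertex_ne_edge h)

theorem ConfPair.up_vertex {β : Finset (ℕ ×ₗ ℕ)} (hp : ConfPair m {col a b} β) :
    (∃ c d, PairSecond m a b c d ∧ β = {col a b, col c d}) ∨
    (a = m - 1 ∧ b = m ∧ β = {col (m - 1) (m - 2), col (m - 1) m}) := by
  generalize hα : ({col a b} : Finset (ℕ ×ₗ ℕ)) = α at hp
  cases hp with
  | last hp => exact absurd hα (vertex_ne_edge hp.lt.1)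
  | middle hp => exact absurd hα (vertex_ne_edge (hp.lt.1.trans hp.lt.2))
  | second hp =>
    obtain ⟨rfl, rfl⟩ := vertex_eq_iff.1 hα
    exact Or.inl ⟨_, _, hp, rfl⟩
  | first =>
    obtain ⟨rfl, rfl⟩ := vertex_eq_iff.1 hα
    exact Or.inr ⟨rfl, rfl, rfl⟩

theorem not_confPair_triangle (h : col a b < col e f ∧ col e f < col c d)
    (β : Finset (ℕ ×ₗ ℕ)) : ¬ ConfPair m {col a b, col e f, col c d} β := by
  intro hp
  generalize hα : ({col a b, col e f, col c d} : Finset (ℕ ×ₗ ℕ)) = α at hp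
  cases hp with
  | last hp => exact edge_ne_triangle hp.lt.1 h hα.symm
  | middle hp => exact edge_ne_triangle (hp.lt.1.trans hp.lt.2) h hα.symm
  | second hp => exact vertex_ne_triangle h hα.symm
  | first => exact vertex_ne_triangle h hα.symm

theorem ConfPair.down_edge (hm : 4 ≤ m) (h : col a b < col c d) {α : Finset (ℕ ×ₗ ℕ)}
    (hp : ConfPair m α {col a b, col c d}) :
    (PairSecond m a b c d ∧ α = {col a b}) ∨
    (a = m - 1 ∧ b = m - 2 ∧ c = m - 1 ∧ d = m ∧ α = {col c d}) := by
  generalize hβ : ({col a b, col c d} : Finset (ℕ ×ₗ ℕ)) = β at hp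
  cases hp with
  | last hp => exact absurd hβ (edge_ne_triangle h hp.lt)
  | middle hp => exact absurd hβ (edge_ne_triangle h hp.lt)
  | second hp =>
    obtain ⟨rfl, rfl, rfl, rfl⟩ := (edge_eq_iff h hp.lt).1 hβ
    exact Or.inl ⟨hp, rfl⟩
  | first =>
    obtain ⟨rfl, rfl, rfl, rfl⟩ := (edge_eq_iff h (isEdge_first hm).lt).1 hβ
    exact Or.inr ⟨rfl, rfl, rfl, rfl, rfl⟩

theorem ConfPair.down_triangle (hm : 4 ≤ m) (h : col a b < col e f ∧ col e f < col c d)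
    {α : Finset (ℕ ×ₗ ℕ)} (hp : ConfPair m α {col a b, col e f, col c d}) :
    (PairLast m a b e f c d ∧ α = {col a b, col e f}) ∨
    (PairMiddle m a b e f c d ∧ α = {col a b, col c d}) := by
  generalize hβ : ({col a b, col e f, col c d} : Finset (ℕ ×ₗ ℕ)) = β at hp
  cases hp with
  | last hp =>
    obtain ⟨rfl, rfl, rfl, rfl, rfl, rfl⟩ := (triangle_eq_iff h hp.lt).1 hβ
    exact Or.inl ⟨hp, rfl⟩
  | middle hp =>
    obtain ⟨rfl, rfl, rfl, rfl, rfl, rfl⟩ := (triangle_eq_iff h hp.lt).1 hβ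
    exact Or.inr ⟨hp, rfl⟩
  | second hp => exact absurd hβ.symm (edge_ne_triangle hp.lt h)
  | first => exact absurd hβ.symm (edge_ne_triangle (isEdge_first hm).lt h)

/-- A face is paired upwards with at most one face. -/
theorem ConfPair.right_unique (hm : 4 ≤ m) {α β β' : Finset (ℕ ×ₗ ℕ)} (h : ConfPair m α β)
    (h' : ConfPair m α β') : β = β' := by
  cases h with
  | last h =>
    obtain ⟨x, y, h1, rfl⟩ | ⟨x, y, h1, rfl⟩ := h'.up_edge h.lt.1 <;>
      rw [triangle_eq_iff h.lt h1.lt] <;> simp only [PairLast, PairMiddle, IsTriangle] at h h1 <;>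
      omega
  | middle h =>
    obtain ⟨x, y, h1, rfl⟩ | ⟨x, y, h1, rfl⟩ := h'.up_edge (h.lt.1.trans h.lt.2) <;>
      rw [triangle_eq_iff h.lt h1.lt] <;> simp only [PairLast, PairMiddle, IsTriangle] at h h1 <;>
      omega
  | second h =>
    obtain ⟨x, y, h1, rfl⟩ | ⟨rfl, rfl, rfl⟩ := h'.up_vertex
    · rw [edge_eq_iff h.lt h1.lt]; simp only [PairSecond, IsEdge] at h h1; omega
    · simp only [PairSecond, IsEdge] at h; omega
  | first =>
    obtain ⟨x, y, h1, rfl⟩ | ⟨-, -, rfl⟩ := h'.up_vertex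
    · simp only [PairSecond, IsEdge] at h1; omega
    · rfl

/-- A face is paired downwards with at most one face. -/
theorem ConfPair.left_unique (hm : 4 ≤ m) {α α' β : Finset (ℕ ×ₗ ℕ)} (h : ConfPair m α β)
    (h' : ConfPair m α' β) : α = α' := by
  cases h with
  | last h =>
    obtain ⟨h1, rfl⟩ | ⟨h1, rfl⟩ := h'.down_triangle hm h.lt
    · rfl
    · simp only [PairLast, PairMiddle, IsTriangle] at h h1; omega
  | middle h =>
    obtain ⟨h1, rfl⟩ | ⟨h1, rfl⟩ := h'.down_triangle hm h.lt
    · simp only [PairLast, PairMiddle, IsTriangle] at h h1; omega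
    · rfl
  | second h =>
    obtain ⟨h1, rfl⟩ | ⟨rfl, rfl, rfl, rfl, rfl⟩ := h'.down_edge hm h.lt
    · rfl
    · simp only [PairSecond, IsEdge] at h; omega
  | first =>
    obtain ⟨h1, rfl⟩ | ⟨-, -, -, -, rfl⟩ := h'.down_edge hm (isEdge_first hm).lt
    · simp only [PairSecond, IsEdge] at h1; omega
    · rfl

/-- No face is paired both upwards and downwards. -/
theorem ConfPair.not_both (hm : 4 ≤ m) {α β γ : Finset (ℕ ×ₗ ℕ)} (h : ConfPair m α β)
    (h' : ConfPair m β γ) : False := by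
  cases h with
  | last h => exact not_confPair_triangle h.lt _ h'
  | middle h => exact not_confPair_triangle h.lt _ h'
  | second h =>
    obtain ⟨x, y, h1, rfl⟩ | ⟨x, y, h1, rfl⟩ := h'.up_edge h.lt <;>
      simp only [PairLast, PairMiddle, PairSecond, IsTriangle, IsEdge] at h h1 <;> omega
  | first =>
    obtain ⟨x, y, h1, rfl⟩ | ⟨x, y, h1, rfl⟩ := h'.up_edge (isEdge_first hm).lt <;>
      simp only [PairLast, PairMiddle, IsTriangle] at h1 <;> omega

theorem ConfPair.matching (hm : 4 ≤ m) {α β α' β' : Finset (ℕ ×ₗ ℕ)} (h : ConfPair m α β)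
    (h' : ConfPair m α' β') (hs : α = α' ∨ α = β' ∨ β = α' ∨ β = β') : α = α' ∧ β = β' := by
  rcases hs with rfl | rfl | rfl | rfl
  · exact ⟨rfl, h.right_unique hm h'⟩
  · exact (h'.not_both hm h).elim
  · exact (h.not_both hm h').elim
  · exact ⟨h.left_unique hm h', rfl⟩

/-- The pairing `[a, e; b, f] ↗ [a, e, c; b, f, d]` blocks a candidate pairing `β.erase v ↗ β` which
has a face in common with it if `v` is not in last position or is smaller than `[c; d]`. -/
theorem blocked_of_pairLast (h : PairLast m a b e f c d) {β : Finset (ℕ ×ₗ ℕ)} {v : ℕ ×ₗ ℕ}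
    (hβ : β.card = 3) (hs : {col a b, col e f} = β.erase v ∨ {col a b, col e f, col c d} = β)
    (hv : position β v < 2 ∨ position β v = 2 ∧ v < col c d) :
    ∃ β', ∃ v' ∈ β', ConfPair m (β'.erase v') β' ∧
      (β'.erase v' = β.erase v ∨ β'.erase v' = β ∨ β' = β.erase v ∨ β' = β) ∧
      Precedes (β'.card - 2) (position β' v') v' (β.card - 2) (position β v) v := by
  obtain ⟨h1, h2⟩ := h.lt
  refine ⟨{col a b, col e f, col c d}, col c d, by simp, ?_, ?_, ?_⟩
  · rw [erase_triple_right h1 h2]; exact .last h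
  · rw [erase_triple_right h1 h2]; tauto
  · rw [card_triple_of_lt h1 h2, position_triple_right h1 h2, hβ]
    unfold Precedes
    rcases hv with hv | ⟨hv, hv'⟩
    · omega
    · exact Or.inr ⟨rfl, Or.inr ⟨hv.symm, hv'⟩⟩

theorem blocked_of_pairMiddle (h : PairMiddle m a b e f c d) {β : Finset (ℕ ×ₗ ℕ)} {v : ℕ ×ₗ ℕ}
    (hβ : β.card = 3) (hs : {col a b, col c d} = β.erase v ∨ {col a b, col e f, col c d} = β)
    (hv : position β v < 1 ∨ position β v = 1 ∧ v < col e f) :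
    ∃ β', ∃ v' ∈ β', ConfPair m (β'.erase v') β' ∧
      (β'.erase v' = β.erase v ∨ β'.erase v' = β ∨ β' = β.erase v ∨ β' = β) ∧
      Precedes (β'.card - 2) (position β' v') v' (β.card - 2) (position β v) v := by
  obtain ⟨h1, h2⟩ := h.lt
  refine ⟨{col a b, col e f, col c d}, col e f, by simp, ?_, ?_, ?_⟩
  · rw [erase_triple_middle h1 h2]; exact .middle h
  · rw [erase_triple_middle h1 h2]; tauto
  · rw [card_triple_of_lt h1 h2, position_triple_middle h1 h2, hβ]
    unfold Precedes
    rcases hv with hv | ⟨hv, hv'⟩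
    · omega
    · exact Or.inr ⟨rfl, Or.inr ⟨hv.symm, hv'⟩⟩

theorem blocked_of_pairSecond (h : PairSecond m a b c d) {β : Finset (ℕ ×ₗ ℕ)} {v : ℕ ×ₗ ℕ}
    (hβ : β.card = 2) (hs : {col a b} = β.erase v ∨ {col a b, col c d} = β)
    (hv : position β v < 1 ∨ position β v = 1 ∧ v < col c d) :
    ∃ β', ∃ v' ∈ β', ConfPair m (β'.erase v') β' ∧
      (β'.erase v' = β.erase v ∨ β'.erase v' = β ∨ β' = β.erase v ∨ β' = β) ∧
      Precedes (β'.card - 2) (position β' v') v' (β.card - 2) (position β v) v := by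
  refine ⟨{col a b, col c d}, col c d, by simp, ?_, ?_, ?_⟩
  · rw [erase_pair_right h.lt]; exact .second h
  · rw [erase_pair_right h.lt]; tauto
  · rw [card_pair_of_lt h.lt, position_pair_right h.lt, hβ]
    unfold Precedes
    rcases hv with hv | ⟨hv, hv'⟩
    · omega
    · exact Or.inr ⟨rfl, Or.inr ⟨hv.symm, hv'⟩⟩

theorem blocked_of_first (hm : 4 ≤ m) {β : Finset (ℕ ×ₗ ℕ)} {v : ℕ ×ₗ ℕ}
    (hβ : β.card = 2) (hs : {col (m - 1) m} = β.erase v)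
    (hv : position β v = 0) (hv' : v < col (m - 1) (m - 2)) :
    ∃ β', ∃ v' ∈ β', ConfPair m (β'.erase v') β' ∧
      (β'.erase v' = β.erase v ∨ β'.erase v' = β ∨ β' = β.erase v ∨ β' = β) ∧
      Precedes (β'.card - 2) (position β' v') v' (β.card - 2) (position β v) v := by
  have h := (isEdge_first hm).lt
  refine ⟨{col (m - 1) (m - 2), col (m - 1) m}, col (m - 1) (m - 2), by simp, ?_, ?_, ?_⟩
  · rw [erase_pair_left h]; exact .first
  · rw [erase_pair_left h]; tauto
  · rw [card_pair_of_lt h, position_pair_left h, hβ, hv]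
    exact Or.inr ⟨rfl, Or.inr ⟨rfl, hv'⟩⟩

/-- If a `2`-face is not paired with the facet opposite to its last vertex, this facet is paired
with the `2`-face obtained by adding a larger last vertex. -/
theorem exists_pairLast_of_not (hm : 4 ≤ m) (h : IsTriangle m a b e f c d)
    (h1 : ¬ PairLast m a b e f c d) :
    ∃ x y, PairLast m a b e f x y ∧ col c d < col x y := by
  have h0 := h
  obtain ⟨k1, k2, k3, k4, k5, k6, k7, k8, k9, ⟨rfl, rfl⟩ | ⟨rfl, rfl⟩⟩ := h
  · have h2 : ¬ (c = m ∧ f < m ∨ c = m - 1 ∧ f = m) := fun h => h1 ⟨h0, Or.inl ⟨rfl, rfl, h⟩⟩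
    by_cases h3 : f = m
    · exact ⟨m - 1, f, ⟨.mk_left (by omega) (by omega) (by omega) (by omega) (by omega) (by omega)
        (by omega) (by omega) (by omega), by omega⟩, by rw [col_lt]; omega⟩
    · exact ⟨m, f, ⟨.mk_left (by omega) (by omega) (by omega) (by omega) (by omega) (by omega)
        (by omega) (by omega) (by omega), by omega⟩, by rw [col_lt]; omega⟩
  · have h2 : ¬ (e < m ∧ d = m ∨ e = m ∧ d = m - 1) := fun h => h1 ⟨h0, Or.inr ⟨rfl, rfl, h⟩⟩
    by_cases h3 : e = m
    · exact ⟨e, m - 1, ⟨.mk_right (by omega) (by omega) (by omega) (by omega) (by omega) (by omega)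
        (by omega) (by omega) (by omega), by omega⟩, by rw [col_lt]; omega⟩
    · exact ⟨e, m, ⟨.mk_right (by omega) (by omega) (by omega) (by omega) (by omega) (by omega)
        (by omega) (by omega) (by omega), by omega⟩, by rw [col_lt]; omega⟩

/-- The shape of the `2`-faces which are paired neither with the facet opposite to their last vertex
nor with the one opposite to their middle vertex. -/
theorem IsTriangle.of_not_pair (h : IsTriangle m a b e f c d)
    (h1 : ¬ PairLast m a b e f c d) (h2 : ¬ PairMiddle m a b e f c d) :
    e = a ∧ f = d ∧ c < m ∧ d < m ∧ c ≠ b := by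
  have h0 := h
  obtain ⟨k1, k2, k3, k4, k5, k6, k7, k8, k9, ⟨rfl, rfl⟩ | ⟨rfl, rfl⟩⟩ := h
  · have h3 : ¬ (c = m ∧ f < m ∨ c = m - 1 ∧ f = m) := fun h => h1 ⟨h0, Or.inl ⟨rfl, rfl, h⟩⟩
    have h4 : ¬ (c = b ∧ f < m ∨ f = m ∧ c < m - 1) := fun h => h2 ⟨h0, Or.inr ⟨rfl, rfl, h⟩⟩
    omega
  · have h3 : ¬ (e < m ∧ d = m ∨ e = m ∧ d = m - 1) := fun h => h1 ⟨h0, Or.inr ⟨rfl, rfl, h⟩⟩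
    have h4 : ¬ (d < m ∧ ¬ (e = m ∧ d = m - 1)) := fun h => h2 ⟨h0, Or.inl ⟨rfl, rfl, h⟩⟩
    omega

/-- The facet opposite to the middle vertex is paired by adding the corner `[c; b]`, which is
lexicographically larger than the corner `[a; d]`. -/
theorem pairMiddle_of_not (h : IsTriangle m a b e f c d)
    (h1 : ¬ PairLast m a b e f c d) (h2 : ¬ PairMiddle m a b e f c d) :
    PairMiddle m a b c b c d ∧ col e f < col c b := by
  have h3 := h.of_not_pair h1 h2
  obtain ⟨k1, k2, k3, k4, k5, k6, k7, k8, k9, -⟩ := h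
  rw [col_lt]
  exact ⟨⟨.mk_right (by omega) (by omega) (by omega) (by omega) (by omega) (by omega)
        (by omega) (by omega) (by omega), by omega⟩,
    by omega⟩

/-- The facet opposite to the first vertex is paired by adding the last column `[c; m]`. -/
theorem pairLast_of_not (h : IsTriangle m a b e f c d)
    (h1 : ¬ PairLast m a b e f c d) (h2 : ¬ PairMiddle m a b e f c d) :
    PairLast m e f c d c m := by
  obtain ⟨rfl, rfl, h3⟩ := h.of_not_pair h1 h2
  obtain ⟨k1, k2, k3, k4, k5, k6, k7, k8, k9, -⟩ := h
  exact ⟨.mk_right (by omega) (by omega) (by omega) (by omega) (by omega) (by omega)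
        (by omega) (by omega) (by omega), by omega⟩

/-- If a `1`-face is not paired with its first vertex, this vertex is paired with the `1`-face
obtained by adding a larger last vertex. -/
theorem exists_pairSecond (h : IsEdge m a b c d) (h1 : ¬ PairSecond m a b c d) :
    ∃ x y, PairSecond m a b x y ∧ col c d < col x y := by
  simp only [PairSecond, col_lt]
  unfold PairSecond at h1
  unfold IsEdge at *
  by_cases h3 : b = m
  · exact ⟨m - 1, m, by omega⟩
  · exact ⟨m, m - 1, by omega⟩

/-- The algorithm, run on `C_m`, produces the matching `ConfPair m`. -/
theorem mem_confField (hm : 4 ≤ m) (x : Finset (ℕ ×ₗ ℕ) × Finset (ℕ ×ₗ ℕ)) :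
    x ∈ confField m ↔ ConfPair m x.1 x.2 := by
  refine mem_gradientField_iff _ _ (fun _ _ h => h.facet hm)
    (fun _ _ _ _ h h' => h.matching hm h') ?_ x
  intro β hβ v hv hne hnot
  rcases (mem_confComplex β).1 hβ with ⟨a, b, -, rfl⟩ | ⟨a, b, c, d, h, rfl⟩ |
    ⟨a, b, e, f, c, d, h, rfl⟩
  · rw [Finset.mem_singleton] at hv
    subst hv
    simp at hne
  · have hlt := h.lt
    have hcard := card_pair_of_lt hlt
    simp only [Finset.mem_insert, Finset.mem_singleton] at hv
    rcases hv with rfl | rfl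
    · have hpos := position_pair_left hlt
      have her := erase_pair_left hlt
      rw [her] at hnot
      by_cases h1 : c = m ∧ d = m - 1
      · exact blocked_of_pairSecond (a := a) (b := b) (c := c) (d := d) ⟨h, Or.inl h1⟩ hcard
          (Or.inr rfl) (by omega)
      by_cases h2 : c = m - 1 ∧ d = m
      · by_cases h3 : b = m
        · exact blocked_of_pairSecond (a := a) (b := b) (c := c) (d := d) ⟨h, Or.inr ⟨h3, h2⟩⟩ hcard
            (Or.inr rfl) (by omega)
        · obtain ⟨rfl, rfl⟩ := h2
          refine blocked_of_first hm hcard (by rw [her]) hpos ?_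
          have h4 : ¬ (a = d - 1 ∧ b = d - 2) := by
            rintro ⟨rfl, rfl⟩; exact hnot .first
          simp only [col_lt]
          simp only [IsEdge] at h
          omega
      · by_cases h3 : d = m
        · exact blocked_of_pairSecond (a := c) (b := d) (c := m - 1) (d := m)
            ⟨by simp only [IsEdge] at h ⊢; omega, by omega⟩ hcard (Or.inl her.symm) (by omega)
        · exact blocked_of_pairSecond (a := c) (b := d) (c := m) (d := m - 1)
            ⟨by simp only [IsEdge] at h ⊢; omega, by omega⟩ hcard (Or.inl her.symm) (by omega)
    · have hpos := position_pair_right hlt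
      have her := erase_pair_right hlt
      rw [her] at hnot
      obtain ⟨x, y, hx, hlt'⟩ := exists_pairSecond h fun h1 => hnot (.second h1)
      exact blocked_of_pairSecond hx hcard (Or.inl her.symm) (Or.inr ⟨hpos, hlt'⟩)
  · obtain ⟨hlt, hlt'⟩ := h.lt
    have hcard := card_triple_of_lt hlt hlt'
    simp only [Finset.mem_insert, Finset.mem_singleton] at hv
    rcases hv with rfl | rfl | rfl
    · have hpos := position_triple_left hlt hlt'
      have her := erase_triple_left hlt hlt'
      by_cases h1 : PairLast m a b e f c d
      · exact blocked_of_pairLast h1 hcard (Or.inr rfl) (by omega)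
      by_cases h2 : PairMiddle m a b e f c d
      · exact blocked_of_pairMiddle h2 hcard (Or.inr rfl) (by omega)
      exact blocked_of_pairLast (pairLast_of_not h h1 h2) hcard (Or.inl her.symm) (by omega)
    · have hpos := position_triple_middle hlt hlt'
      have her := erase_triple_middle hlt hlt'
      rw [her] at hnot
      by_cases h1 : PairLast m a b e f c d
      · exact blocked_of_pairLast h1 hcard (Or.inr rfl) (by omega)
      obtain ⟨h2, hlt''⟩ := pairMiddle_of_not h h1 fun h2 => hnot (.middle h2)
      exact blocked_of_pairMiddle h2 hcard (Or.inl her.symm) (Or.inr ⟨hpos, hlt''⟩)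
    · have hpos := position_triple_right hlt hlt'
      have her := erase_triple_right hlt hlt'
      rw [her] at hnot
      obtain ⟨x, y, hx, hlt''⟩ := exists_pairLast_of_not hm h fun h1 => hnot (.last h1)
      exact blocked_of_pairLast hx hcard (Or.inl her.symm) (Or.inr ⟨hpos, hlt''⟩)

end

/-! ### Acyclicity -/

/-- A rank of `1`-faces which decreases along upper paths. -/
def edgeRank (m a b c d : ℕ) : ℕ :=
  if a = c then (if d = m then 1 else if a = m then 0 else 3)
  else if b = d then (if b = m then 0 else if c = m then 1 else 3)
  else if c = m ∧ d = m - 1 ∨ c = m - 1 ∧ d = m then 0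
  else if c = m ∨ d = m then 2 else 4

section

variable {m a b c d e f : ℕ}

theorem PairLast.edgeRank_lt (h : PairLast m a b e f c d) :
    edgeRank m e f c d < edgeRank m a b e f ∧ edgeRank m a b c d < edgeRank m a b e f := by
  obtain ⟨⟨k1, k2, k3, k4, k5, k6, k7, k8, k9, ⟨rfl, rfl⟩ | ⟨rfl, rfl⟩⟩, h⟩ := h <;>
    unfold edgeRank <;> constructor <;> split_ifs <;> omega

theorem PairMiddle.edgeRank_lt (h : PairMiddle m a b e f c d) :
    edgeRank m e f c d < edgeRank m a b c d ∧ edgeRank m a b e f < edgeRank m a b c d := by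
  obtain ⟨⟨k1, k2, k3, k4, k5, k6, k7, k8, k9, ⟨rfl, rfl⟩ | ⟨rfl, rfl⟩⟩, h⟩ := h <;>
    unfold edgeRank <;> constructor <;> split_ifs <;> omega

/-- An upper step out of `α` passes to another facet of the partner `β` of `α`. -/
theorem acc_of_forall (hm : 4 ≤ m) {α : Finset (ℕ ×ₗ ℕ)}
    (h : ∀ β, ConfPair m α β → ∀ v ∈ β, β.erase v ≠ α →
      Acc (fun δ γ => UpStep (confComplex m) (confField m) γ δ) (β.erase v)) :
    Acc (fun δ γ => UpStep (confComplex m) (confField m) γ δ) α := by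
  refine Acc.intro _ ?_
  rintro δ ⟨β, hβ, hd⟩
  have hp := (mem_confField hm _).1 hβ
  obtain ⟨hβf, w, hw, hαw, hαne⟩ := hp.facet hm
  have hcard := Finset.card_erase_of_mem hw
  rw [← hαw] at hcard
  have := hαne.card_pos
  obtain ⟨⟨v, hv, rfl⟩, hW⟩ := (downEdge_iff hβf (by omega)).1 hd
  exact h β hp v hv fun he => hW (he ▸ hβ)

theorem acc_edge (hm : 4 ≤ m) (h : col a b < col c d) :
    Acc (fun δ γ => UpStep (confComplex m) (confField m) γ δ) {col a b, col c d} := by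
  induction hn : edgeRank m a b c d using Nat.strong_induction_on generalizing a b c d with
  | _ n ih =>
    subst hn
    refine acc_of_forall hm fun β hβ v hv hne => ?_
    obtain ⟨e, f, hp, rfl⟩ | ⟨e, f, hp, rfl⟩ := hβ.up_edge h
    · obtain ⟨h1, h2⟩ := hp.lt
      obtain ⟨r1, r2⟩ := hp.edgeRank_lt
      simp only [Finset.mem_insert, Finset.mem_singleton] at hv
      rcases hv with rfl | rfl | rfl
      · rw [erase_triple_left h1 h2]; exact ih _ r1 h2 rfl
      · rw [erase_triple_middle h1 h2]; exact ih _ r2 (h1.trans h2) rfl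
      · exact absurd (erase_triple_right h1 h2) hne
    · obtain ⟨h1, h2⟩ := hp.lt
      obtain ⟨r1, r2⟩ := hp.edgeRank_lt
      simp only [Finset.mem_insert, Finset.mem_singleton] at hv
      rcases hv with rfl | rfl | rfl
      · rw [erase_triple_left h1 h2]; exact ih _ r1 h2 rfl
      · exact absurd (erase_triple_middle h1 h2) hne
      · rw [erase_triple_right h1 h2]; exact ih _ r2 h1 rfl

theorem acc_vertex_of_forall (hm : 4 ≤ m)
    (h : ∀ c d, PairSecond m a b c d →
      Acc (fun δ γ => UpStep (confComplex m) (confField m) γ δ) {col c d})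
    (h' : a = m - 1 → b = m →
      Acc (fun δ γ => UpStep (confComplex m) (confField m) γ δ) {col (m - 1) (m - 2)}) :
    Acc (fun δ γ => UpStep (confComplex m) (confField m) γ δ) {col a b} := by
  refine acc_of_forall hm fun β hβ v hv hne => ?_
  obtain ⟨c, d, hp, rfl⟩ | ⟨rfl, rfl, rfl⟩ := hβ.up_vertex
  · simp only [Finset.mem_insert, Finset.mem_singleton] at hv
    rcases hv with rfl | rfl
    · rw [erase_pair_left hp.lt]; exact h c d hp
    · exact absurd (erase_pair_right hp.lt) hne
  · simp only [Finset.mem_insert, Finset.mem_singleton] at hv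
    rcases hv with rfl | rfl
    · exact absurd (erase_pair_left (isEdge_first hm).lt) hne
    · rw [erase_pair_right (isEdge_first hm).lt]; exact h' rfl rfl

theorem acc_vertex (hm : 4 ≤ m) (a b : ℕ) :
    Acc (fun δ γ => UpStep (confComplex m) (confField m) γ δ) {col a b} := by
  have h1 : Acc (fun δ γ => UpStep (confComplex m) (confField m) γ δ) {col m (m - 1)} := by
    refine acc_vertex_of_forall hm (fun c d h => ?_) (by omega)
    unfold PairSecond IsEdge at h
    omega
  have h2 : ∀ a b, b ≠ m →
      Acc (fun δ γ => UpStep (confComplex m) (confField m) γ δ) {col a b} := by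
    intro a b hb
    refine acc_vertex_of_forall hm (fun c d h => ?_) (by omega)
    obtain ⟨-, ⟨rfl, rfl⟩ | h⟩ := h
    · exact h1
    · omega
  have h3 : Acc (fun δ γ => UpStep (confComplex m) (confField m) γ δ) {col (m - 1) m} := by
    refine acc_vertex_of_forall hm (fun c d h => ?_) fun _ _ => h2 _ _ (by omega)
    unfold PairSecond IsEdge at h
    omega
  refine acc_vertex_of_forall hm (fun c d h => ?_) fun _ _ => h2 _ _ (by omega)
  obtain ⟨-, ⟨rfl, rfl⟩ | ⟨-, rfl, rfl⟩⟩ := h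
  · exact h1
  · exact h3

theorem acc_upStep (hm : 4 ≤ m) (α : Finset (ℕ ×ₗ ℕ)) :
    Acc (fun δ γ => UpStep (confComplex m) (confField m) γ δ) α := by
  by_cases h : ∃ β, ConfPair m α β
  · obtain ⟨β, h⟩ := h
    cases h with
    | last h => exact acc_edge hm h.lt.1
    | middle h => exact acc_edge hm (h.lt.1.trans h.lt.2)
    | second h => exact acc_vertex hm _ _
    | first => exact acc_vertex hm _ _
  · exact acc_of_forall hm fun β hβ => absurd ⟨β, hβ⟩ h

theorem isGradientField_confField (hm : 4 ≤ m) :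
    (confComplex m).IsGradientField (confField m) where
  facet := by
    rintro ⟨α, β⟩ h
    obtain ⟨hβ, v, hv, hα, hne⟩ := ((mem_confField hm _).1 h).facet hm
    simp only at hβ hv hα hne ⊢
    subst hα
    refine ⟨?_, hβ, Finset.erase_subset _ _, (Finset.card_erase_add_one hv).symm⟩
    rw [mem_faceFinset] at hβ ⊢
    exact ((confComplex m).isRelLowerSet_faces hβ).2 (Finset.erase_subset _ _) hne
  matching := by
    rintro ⟨α, β⟩ h ⟨α', β'⟩ h' hs
    obtain ⟨rfl, rfl⟩ := ((mem_confField hm _).1 h).matching hm ((mem_confField hm _).1 h') hs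
    rfl
  acyclic := not_transGen_of_wellFounded (acc_upStep hm)

/-! ### Critical faces -/

theorem mem_confCritical (hm : 4 ≤ m) {p : ℕ} {σ : Finset (ℕ ×ₗ ℕ)} : σ ∈ confCritical m p ↔
    σ ∈ (confComplex m).faceFinset ∧ σ.card = p + 1 ∧
      ∀ β, ¬ ConfPair m σ β ∧ ¬ ConfPair m β σ := by
  rw [confCritical, criticalFaces, Finset.mem_filter, mem_facesOfDim, and_assoc]
  refine and_congr_right fun _ => and_congr_right fun _ => ⟨fun h β => ⟨fun h' => ?_, fun h' => ?_⟩,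
    fun h e he => ⟨?_, ?_⟩⟩
  · exact (h (σ, β) ((mem_confField hm _).2 h')).1 rfl
  · exact (h (β, σ) ((mem_confField hm _).2 h')).2 rfl
  · rintro rfl
    exact (h _).1 ((mem_confField hm _).1 he)
  · rintro rfl
    exact (h _).2 ((mem_confField hm _).1 he)

theorem cols_edge (a b c d : ℕ) : cols !![a, c; b, d] = {col a b, col c d} := by
  ext; simp [cols, col, Fin.exists_fin_two, eq_comm]

theorem cols_triangle (a b e f c d : ℕ) :
    cols !![a, e, c; b, f, d] = {col a b, col e f, col c d} := by
  ext; simp [cols, col, Fin.exists_fin_succ, eq_comm]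

theorem not_confPair_edge (h : col a b < col c d) (h1 : ∀ e f, ¬ PairLast m a b c d e f)
    (h2 : ∀ e f, ¬ PairMiddle m a b e f c d) (β : Finset (ℕ ×ₗ ℕ)) :
    ¬ ConfPair m {col a b, col c d} β := fun hβ => by
  obtain ⟨e, f, hp, -⟩ | ⟨e, f, hp, -⟩ := hβ.up_edge h
  exacts [h1 _ _ hp, h2 _ _ hp]

theorem not_pairLast_edge (h : a = m ∨ a = m - 1 ∧ d = m ∨ b = m ∨ c = m ∧ d = m - 1 ∨
    a ≠ c ∧ b ≠ d) (e f : ℕ) : ¬ PairLast m a b c d e f := by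
  rintro ⟨⟨k1, k2, k3, k4, k5, k6, k7, k8, k9, ⟨rfl, rfl⟩ | ⟨rfl, rfl⟩⟩, h'⟩ <;> omega

theorem not_pairMiddle_edge (h : a = c ∨ b = d ∨ c = m ∧ d = m - 1 ∨ c = m - 1 ∧ d = m) (e f : ℕ) :
    ¬ PairMiddle m a b e f c d := by
  rintro ⟨⟨k1, k2, k3, k4, k5, k6, k7, k8, k9, ⟨rfl, rfl⟩ | ⟨rfl, rfl⟩⟩, h'⟩ <;> omega

theorem edge_mem_confCritical_of_not (hm : 4 ≤ m) (h : IsEdge m a b c d)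
    (h1 : a = m ∨ a = m - 1 ∧ d = m ∨ b = m ∨ c = m ∧ d = m - 1 ∨ a ≠ c ∧ b ≠ d)
    (h2 : a = c ∨ b = d ∨ c = m ∧ d = m - 1 ∨ c = m - 1 ∧ d = m)
    (h3 : ¬ (c = m ∧ d = m - 1 ∨ b = m ∧ c = m - 1 ∧ d = m))
    (h4 : ¬ (a = m - 1 ∧ b = m - 2)) : {col a b, col c d} ∈ confCritical m 1 := by
  refine (mem_confCritical hm).2 ⟨edge_mem h, card_pair_of_lt h.lt, fun β =>
    ⟨not_confPair_edge h.lt (not_pairLast_edge h1) (not_pairMiddle_edge h2) β, fun hβ => ?_⟩⟩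
  obtain ⟨⟨-, hp⟩, -⟩ | ⟨hp1, hp2, -⟩ := hβ.down_edge hm h.lt
  exacts [h3 hp, h4 ⟨hp1, hp2⟩]

theorem TypeK1.mem_confCritical (hm : 4 ≤ m) (h : TypeK1 m a b) :
    {col a b, col (m - 1) m} ∈ confCritical m 1 := by
  obtain ⟨h1, h2, h3, h4⟩ := h
  refine edge_mem_confCritical_of_not hm ?_ ?_ ?_ ?_ ?_
  · unfold IsEdge; refine ⟨?_, ?_, ?_, ?_, ?_, ?_, ?_, ?_, ?_⟩ <;> omega
  all_goals omega

theorem TypeK23.mem_confCritical_left (hm : 4 ≤ m) (h : TypeK23 m b d) :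
    {col m b, col m d} ∈ confCritical m 1 := by
  obtain ⟨h1, h2, h3⟩ := h
  refine edge_mem_confCritical_of_not hm ?_ ?_ ?_ ?_ ?_
  · unfold IsEdge; refine ⟨?_, ?_, ?_, ?_, ?_, ?_, ?_, ?_, ?_⟩ <;> omega
  all_goals omega

theorem TypeK23.mem_confCritical_right (hm : 4 ≤ m) (h : TypeK23 m a c) :
    {col a m, col c m} ∈ confCritical m 1 := by
  obtain ⟨h1, h2, h3⟩ := h
  refine edge_mem_confCritical_of_not hm ?_ ?_ ?_ ?_ ?_
  · unfold IsEdge; refine ⟨?_, ?_, ?_, ?_, ?_, ?_, ?_, ?_, ?_⟩ <;> omega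
  all_goals omega

/-- The parameters of a critical `1`-face. -/
theorem type_of_edge_mem_confCritical (hm : 4 ≤ m) (h : IsEdge m a b c d)
    (hσ : {col a b, col c d} ∈ confCritical m 1) :
    (TypeK1 m a b ∧ c = m - 1 ∧ d = m) ∨ (a = m ∧ c = m ∧ TypeK23 m b d) ∨
      (b = m ∧ d = m ∧ TypeK23 m a c) := by
  obtain ⟨-, -, hcrit⟩ := (mem_confCritical hm).1 hσ
  have hlast : ∀ e f, ¬ PairLast m a b c d e f := fun e f hp => (hcrit _).1 (.last hp)
  have hmid : ∀ e f, ¬ PairMiddle m a b e f c d := fun e f hp => (hcrit _).1 (.middle hp)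
  have hsec : ¬ (c = m ∧ d = m - 1 ∨ b = m ∧ c = m - 1 ∧ d = m) := fun hp =>
    (hcrit _).2 (.second ⟨h, hp⟩)
  have hfirst : ¬ (a = m - 1 ∧ b = m - 2 ∧ c = m - 1 ∧ d = m) := by
    rintro ⟨rfl, rfl, rfl, rfl⟩
    exact (hcrit _).2 .first
  obtain ⟨k1, k2, k3, k4, k5, k6, k7, k8, k9⟩ := h
  unfold TypeK1 TypeK23
  by_cases hac : a = c
  · subst hac
    have h1 : ¬ (a < m ∧ d < m) := fun hp => hlast m d
      ⟨.mk_left (by omega) (by omega) (by omega) (by omega) (by omega) (by omega) (by omega)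
        (by omega) (by omega), by omega⟩
    have h2 : ¬ (d = m ∧ a < m - 1) := fun hp => hlast (m - 1) m
      ⟨hp.1 ▸ .mk_left (by omega) (by omega) (by omega) (by omega) (by omega) (by omega)
        (by omega) (by omega) (by omega), by omega⟩
    omega
  by_cases hbd : b = d
  · subst hbd
    have h1 : ¬ (c < m ∧ b < m) := fun hp => hlast c m
      ⟨.mk_right (by omega) (by omega) (by omega) (by omega) (by omega) (by omega) (by omega)
        (by omega) (by omega), by omega⟩
    have h2 : ¬ (c = m ∧ b < m - 1) := fun hp => hlast m (m - 1)
      ⟨hp.1 ▸ .mk_right (by omega) (by omega) (by omega) (by omega) (by omega) (by omega)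
        (by omega) (by omega) (by omega), by omega⟩
    omega
  have h1 : ¬ (c ≠ b ∧ d < m) := fun hp => hmid c b
      ⟨.mk_right (by omega) (by omega) (by omega) (by omega) (by omega) (by omega) (by omega)
        (by omega) (by omega), by omega⟩
  have h2 : ¬ (c = b ∧ d < m ∨ d = m ∧ c < m - 1) := fun hp => hmid a d
      ⟨.mk_left (by omega) (by omega) (by omega) (by omega) (by omega) (by omega)
        (by omega) (by omega) (by omega), by omega⟩
  omega

theorem mem_confCritical_one (hm : 4 ≤ m) (σ : Finset (ℕ ×ₗ ℕ)) : σ ∈ confCritical m 1 ↔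
    (∃ a b, TypeK1 m a b ∧ σ = cols !![a, m - 1; b, m]) ∨
    (∃ b d, TypeK23 m b d ∧ σ = cols !![m, m; b, d]) ∨
    (∃ a c, TypeK23 m a c ∧ σ = cols !![a, c; m, m]) := by
  simp only [cols_edge]
  constructor
  · intro hσ
    have hσ' := (mem_confCritical hm).1 hσ
    rcases (mem_confComplex σ).1 hσ'.1 with ⟨a, b, -, rfl⟩ | ⟨a, b, c, d, h, rfl⟩ |
      ⟨a, b, e, f, c, d, h, rfl⟩
    · simp at hσ'
    · rcases type_of_edge_mem_confCritical hm h hσ with ⟨hK, rfl, rfl⟩ | ⟨rfl, rfl, hK⟩ |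
        ⟨rfl, rfl, hK⟩
      · exact Or.inl ⟨_, _, hK, rfl⟩
      · exact Or.inr (Or.inl ⟨_, _, hK, rfl⟩)
      · exact Or.inr (Or.inr ⟨_, _, hK, rfl⟩)
    · have := hσ'.2.1
      rw [card_triple_of_lt h.lt.1 h.lt.2] at this
      omega
  · rintro (⟨a, b, h, rfl⟩ | ⟨b, d, h, rfl⟩ | ⟨a, c, h, rfl⟩)
    exacts [h.mem_confCritical hm, h.mem_confCritical_left hm, h.mem_confCritical_right hm]

theorem TypeL.isTriangle (h : TypeL m a b c d) : IsTriangle m a b a d c d := by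
  obtain ⟨h1, h2, h3, h4, h5, h6, h7, h8, h9, h10⟩ := h
  exact .mk_left h1 h2 h3 h4 h5.le h6.le h7 h9 h8

theorem TypeL.mem_confCritical (hm : 4 ≤ m) (h : TypeL m a b c d) :
    {col a b, col a d, col c d} ∈ confCritical m 2 := by
  have hlt := h.isTriangle.lt
  refine (_root_.mem_confCritical hm).2 ⟨triangle_mem h.isTriangle, card_triple_of_lt hlt.1 hlt.2,
    fun β => ⟨not_confPair_triangle hlt β, fun hβ => ?_⟩⟩
  obtain ⟨h1, h2, h3, h4, h5, h6, h7, h8, h9, h10⟩ := h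
  obtain ⟨⟨-, h⟩, -⟩ | ⟨⟨-, h⟩, -⟩ := hβ.down_triangle hm hlt <;> omega

theorem mem_confCritical_two (hm : 4 ≤ m) (σ : Finset (ℕ ×ₗ ℕ)) : σ ∈ confCritical m 2 ↔
    ∃ a b c d, TypeL m a b c d ∧ σ = cols !![a, a, c; b, d, d] := by
  simp only [cols_triangle]
  constructor
  · intro hσ
    have hσ' := (mem_confCritical hm).1 hσ
    rcases (mem_confComplex σ).1 hσ'.1 with ⟨a, b, -, rfl⟩ | ⟨a, b, c, d, h, rfl⟩ |
      ⟨a, b, e, f, c, d, h, rfl⟩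
    · simp at hσ'
    · have := hσ'.2.1
      rw [card_pair_of_lt h.lt] at this
      omega
    · have h3 := h.of_not_pair (fun h1 => (hσ'.2.2 _).2 (.last h1))
        (fun h1 => (hσ'.2.2 _).2 (.middle h1))
      obtain ⟨rfl, rfl, h3⟩ := h3
      obtain ⟨h1, h2, h3, h4, h5, h6, h7, h8, h9, h10⟩ := h
      exact ⟨e, b, c, f, by unfold TypeL; omega, rfl⟩
  · rintro ⟨a, b, c, d, h, rfl⟩
    exact h.mem_confCritical hm

theorem cols_mem_confCritical_two (hm : 4 ≤ m) (a b c d : ℕ) :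
    cols !![a, a, c; b, d, d] ∈ confCritical m 2 ↔ TypeL m a b c d := by
  refine ⟨fun hσ => ?_, fun h => (mem_confCritical_two hm _).2 ⟨_, _, _, _, h, rfl⟩⟩
  obtain ⟨a', b', c', d', h, he⟩ := (mem_confCritical_two hm _).1 hσ
  simp only [cols_triangle] at he
  -- the three columns of the critical face are columns of the given matrix
  have h1 : col a' b' ∈ ({col a b, col a d, col c d} : Finset (ℕ ×ₗ ℕ)) := by simp [he]
  have h2 : col a' d' ∈ ({col a b, col a d, col c d} : Finset (ℕ ×ₗ ℕ)) := by simp [he]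
  have h3 : col c' d' ∈ ({col a b, col a d, col c d} : Finset (ℕ ×ₗ ℕ)) := by simp [he]
  simp only [Finset.mem_insert, Finset.mem_singleton, col_inj] at h1 h2 h3
  have hac := h.2.2.1
  have hbd := h.2.2.2.1
  obtain ⟨rfl, rfl, rfl, rfl⟩ : a = a' ∧ b = b' ∧ c = c' ∧ d = d' := by
    refine ⟨?_, ?_, ?_, ?_⟩ <;> omega
  exact h

end

/-! ### Path sums of the configuration complex -/

/-- The sum of the multiplicities of all upper paths in `C_m` from `[a, c; b, d]` to `α`. -/
def edgeSum (m : ℕ) (α : Finset (ℕ ×ₗ ℕ)) (a b c d : ℕ) : ℤ :=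
  pathSum (confComplex m) (confField m) {col a b, col c d} α

/-- The contribution `1` or `0` of the constant path at `[a, c; b, d]`. -/
def edgeIndicator (α : Finset (ℕ ×ₗ ℕ)) (a b c d : ℕ) : ℤ :=
  if {col a b, col c d} = α then 1 else 0

section

variable {m a b c d e f : ℕ} {α : Finset (ℕ ×ₗ ℕ)}

theorem edgeIndicator_eq_zero_of_up (hm : 4 ≤ m) (hα : α ∈ confCritical m 1)
    {β : Finset (ℕ ×ₗ ℕ)} (h : ConfPair m {col a b, col c d} β) : edgeIndicator α a b c d = 0 := by
  refine if_neg ?_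
  rintro rfl
  exact (((mem_confCritical hm).1 hα).2.2 β).1 h

theorem edgeIndicator_eq_zero_of_down (hm : 4 ≤ m) (hα : α ∈ confCritical m 1)
    {β : Finset (ℕ ×ₗ ℕ)} (h : ConfPair m β {col a b, col c d}) : edgeIndicator α a b c d = 0 := by
  refine if_neg ?_
  rintro rfl
  exact (((mem_confCritical hm).1 hα).2.2 β).2 h

theorem edgeSum_of_terminal (hm : 4 ≤ m) (h : col a b < col c d)
    (h1 : a = m ∨ a = m - 1 ∧ d = m ∨ b = m ∨ c = m ∧ d = m - 1 ∨ a ≠ c ∧ b ≠ d)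
    (h2 : a = c ∨ b = d ∨ c = m ∧ d = m - 1 ∨ c = m - 1 ∧ d = m) :
    edgeSum m α a b c d = edgeIndicator α a b c d := by
  refine pathSum_of_forall_notMem (fun β hβ => ?_) α
  exact not_confPair_edge h (not_pairLast_edge h1) (not_pairMiddle_edge h2) β
    ((mem_confField hm _).1 hβ)

/-- The first step of an upper path out of `[a, e; b, f]` drops the first or the middle column of
`[a, e, c; b, f, d]`, with the signs `-1` and `1`. -/
theorem edgeSum_of_pairLast (hm : 4 ≤ m) (hα : α ∈ confCritical m 1)
    (h : PairLast m a b e f c d) :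
    edgeSum m α a b e f = edgeSum m α a b c d - edgeSum m α e f c d := by
  obtain ⟨h1, h2⟩ := h.lt
  have hinc := incidence_erase (β := {col a b, col e f, col c d}) (v := col c d) (by simp)
  rw [erase_triple_right h1 h2, position_triple_right h1 h2] at hinc
  have hind := edgeIndicator_eq_zero_of_up hm hα (.last h)
  unfold edgeIndicator at hind
  have hs1 : ({col e f, col c d} : Finset (ℕ ×ₗ ℕ)) ≠ {col a b, col e f} := by
    rw [Ne, pair_inj_of_lt h2 h1]; exact fun h => h1.ne' h.1
  have hs2 : ({col a b, col c d} : Finset (ℕ ×ₗ ℕ)) ≠ {col a b, col e f} := by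
    rw [Ne, pair_inj_of_lt (h1.trans h2) h1]; exact fun h => h2.ne' h.2
  unfold edgeSum
  rw [pathSum_of_mem (isGradientField_confField hm) (acc_upStep hm)
    ((mem_confField hm _).2 (.last h)), hind, hinc,
    Finset.sum_insert (by simp [h1.ne, (h1.trans h2).ne]), Finset.sum_pair h2.ne,
    erase_triple_left h1 h2, erase_triple_middle h1 h2, erase_triple_right h1 h2,
    position_triple_left h1 h2, position_triple_middle h1 h2, if_neg hs1, if_neg hs2, if_pos rfl]
  ring

/-- The first step of an upper path out of `[a, c; b, d]` drops the first or the last column of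
`[a, e, c; b, f, d]`, both with the sign `1`. -/
theorem edgeSum_of_pairMiddle (hm : 4 ≤ m) (hα : α ∈ confCritical m 1)
    (h : PairMiddle m a b e f c d) :
    edgeSum m α a b c d = edgeSum m α a b e f + edgeSum m α e f c d := by
  obtain ⟨h1, h2⟩ := h.lt
  have hinc := incidence_erase (β := {col a b, col e f, col c d}) (v := col e f) (by simp)
  rw [erase_triple_middle h1 h2, position_triple_middle h1 h2] at hinc
  have hind := edgeIndicator_eq_zero_of_up hm hα (.middle h)
  unfold edgeIndicator at hind
  have hs1 : ({col e f, col c d} : Finset (ℕ ×ₗ ℕ)) ≠ {col a b, col c d} := by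
    rw [Ne, pair_inj_of_lt h2 (h1.trans h2)]; exact fun h => h1.ne' h.1
  have hs2 : ({col a b, col e f} : Finset (ℕ ×ₗ ℕ)) ≠ {col a b, col c d} := by
    rw [Ne, pair_inj_of_lt h1 (h1.trans h2)]; exact fun h => h2.ne h.2
  unfold edgeSum
  rw [pathSum_of_mem (isGradientField_confField hm) (acc_upStep hm)
    ((mem_confField hm _).2 (.middle h)), hind, hinc,
    Finset.sum_insert (by simp [h1.ne, (h1.trans h2).ne]), Finset.sum_pair h2.ne,
    erase_triple_left h1 h2, erase_triple_middle h1 h2, erase_triple_right h1 h2,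
    position_triple_left h1 h2, position_triple_right h1 h2, if_neg hs1, if_neg hs2, if_pos rfl]
  ring

theorem isEdge_of (h1 : 1 ≤ a) (h2 : 1 ≤ b) (h3 : a ≤ c) (h4 : b ≤ d) (h5 : c ≤ m) (h6 : d ≤ m)
    (h7 : a ≠ b) (h8 : c ≠ d) (h9 : a ≠ c ∨ b ≠ d) : IsEdge m a b c d :=
  ⟨h1, h2, h3, h4, h5, h6, h7, h8, h9⟩

/-- The `1`-faces which end in `[m; m-1]` are paired with their first vertex, so they are not
critical. -/
theorem edgeIndicator_last_left (hm : 4 ≤ m) (hα : α ∈ confCritical m 1) (h1 : 1 ≤ a) (h2 : 1 ≤ b)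
    (h3 : a ≤ m) (h4 : b ≤ m - 1) (h5 : a ≠ b) (h6 : a ≠ m ∨ b ≠ m - 1) :
    edgeIndicator α a b m (m - 1) = 0 :=
  edgeIndicator_eq_zero_of_down hm hα
    (.second ⟨isEdge_of h1 h2 h3 h4 le_rfl (by omega) h5 (by omega) h6, Or.inl ⟨rfl, rfl⟩⟩)

theorem edgeIndicator_top (hm : 4 ≤ m) (hα : α ∈ confCritical m 1) (h1 : 1 ≤ a) (h2 : a < m - 1) :
    edgeIndicator α a m (m - 1) m = 0 :=
  edgeIndicator_eq_zero_of_down hm hα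
    (.second ⟨isEdge_of h1 (by omega) (by omega) le_rfl (by omega) le_rfl (by omega) (by omega)
      (by omega), Or.inr ⟨rfl, rfl, rfl⟩⟩)

theorem edgeSum_horizontal_top (hm : 4 ≤ m) (h : a < c) :
    edgeSum m α a m c m = edgeIndicator α a m c m :=
  edgeSum_of_terminal hm (by rw [col_lt]; omega) (by omega) (by omega)

theorem edgeSum_vertical_right (hm : 4 ≤ m) (h : b < d) :
    edgeSum m α m b m d = edgeIndicator α m b m d :=
  edgeSum_of_terminal hm (by rw [col_lt]; omega) (by omega) (by omega)

theorem edgeSum_vertical_top (hm : 4 ≤ m) (hα : α ∈ confCritical m 1) (h1 : 1 ≤ a) (h2 : 1 ≤ b)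
    (h3 : a < m) (h4 : b < m) (h5 : a ≠ b) :
    edgeSum m α a b a m = edgeIndicator α a b (m - 1) m := by
  by_cases h : a = m - 1
  · subst h
    exact edgeSum_of_terminal hm (by rw [col_lt]; omega) (by omega) (by omega)
  · rw [edgeSum_of_pairLast hm hα (c := m - 1) (d := m)
      ⟨.mk_left h1 h2 (by omega) h4 (by omega) le_rfl h5 (by omega) (by omega), by omega⟩,
      edgeSum_horizontal_top hm (by omega), edgeIndicator_top hm hα h1 (by omega),
      edgeSum_of_terminal hm (by rw [col_lt]; omega) (by omega) (by omega), sub_zero]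

theorem edgeSum_horizontal_right (hm : 4 ≤ m) (hα : α ∈ confCritical m 1) (h1 : 1 ≤ a) (h2 : 1 ≤ b)
    (h3 : a < m) (h4 : b < m) (h5 : a ≠ b) : edgeSum m α a b m b = 0 := by
  by_cases h : b = m - 1
  · subst h
    rw [edgeSum_of_terminal hm (by rw [col_lt]; omega) (by omega) (by omega),
      edgeIndicator_last_left hm hα h1 h2 h3.le le_rfl h5 (by omega)]
  · rw [edgeSum_of_pairLast hm hα (c := m) (d := m - 1)
      ⟨.mk_right h1 h2 h3 (by omega) le_rfl (by omega) h5 (by omega) (by omega), by omega⟩,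
      edgeSum_vertical_right hm (by omega),
      edgeIndicator_last_left hm hα (by omega) h2 le_rfl (by omega) (by omega) (by omega),
      edgeSum_of_terminal hm (by rw [col_lt]; omega) (by omega) (by omega),
      edgeIndicator_last_left hm hα h1 h2 h3.le (by omega) h5 (by omega), sub_zero]

theorem edgeSum_diagonal_top (hm : 4 ≤ m) (hα : α ∈ confCritical m 1) (h1 : 1 ≤ a) (h2 : 1 ≤ b)
    (h3 : a < c) (h3' : c < m) (h4 : b < m) (h5 : a ≠ b) :
    edgeSum m α a b c m = edgeIndicator α a b (m - 1) m + edgeIndicator α a m c m := by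
  by_cases h : c = m - 1
  · subst h
    rw [edgeSum_of_terminal hm (by rw [col_lt]; omega) (by omega) (by omega),
      edgeIndicator_top hm hα h1 (by omega), add_zero]
  · rw [edgeSum_of_pairMiddle hm hα (e := a) (f := m)
      ⟨.mk_left h1 h2 h3 h4 h3'.le le_rfl h5 (by omega) (by omega), by omega⟩,
      edgeSum_horizontal_top hm h3, edgeSum_vertical_top hm hα h1 h2 (by omega) h4 h5]

theorem edgeSum_horizontal (hm : 4 ≤ m) (hα : α ∈ confCritical m 1) (h1 : 1 ≤ a) (h2 : 1 ≤ b)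
    (h3 : a < c) (h3' : c < m) (h4 : b < m) (h5 : a ≠ b) (h6 : c ≠ b) :
    edgeSum m α a b c b = edgeIndicator α a b (m - 1) m + edgeIndicator α a m c m -
      edgeIndicator α c b (m - 1) m := by
  rw [edgeSum_of_pairLast hm hα (c := c) (d := m)
      ⟨.mk_right h1 h2 h3 h4 h3'.le le_rfl h5 (by omega) h6, by omega⟩,
    edgeSum_diagonal_top hm hα h1 h2 h3 h3' h4 h5,
    edgeSum_vertical_top hm hα (by omega) h2 h3' h4 h6]

theorem edgeSum_diagonal_right (hm : 4 ≤ m) (hα : α ∈ confCritical m 1) (h1 : 1 ≤ a) (h2 : 1 ≤ b)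
    (h3 : a < m) (h4 : b < d) (h4' : d < m) (h5 : a ≠ b) :
    edgeSum m α a b m d = edgeIndicator α m b m d := by
  by_cases h : d = m - 1
  · subst h
    rw [edgeSum_of_terminal hm (by rw [col_lt]; omega) (by omega) (by omega),
      edgeIndicator_last_left hm hα h1 h2 h3.le (by omega) h5 (by omega),
      edgeIndicator_last_left hm hα (by omega) h2 le_rfl (by omega) (by omega) (by omega)]
  · rw [edgeSum_of_pairMiddle hm hα (e := m) (f := b)
      ⟨.mk_right h1 h2 h3 h4 le_rfl h4'.le h5 (by omega) (by omega), by omega⟩,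
      edgeSum_vertical_right hm h4, edgeSum_horizontal_right hm hα h1 h2 h3 (by omega) h5, zero_add]

theorem edgeSum_vertical (hm : 4 ≤ m) (hα : α ∈ confCritical m 1) (h1 : 1 ≤ a) (h2 : 1 ≤ b)
    (h3 : a < m) (h4 : b < d) (h4' : d < m) (h5 : a ≠ b) (h6 : a ≠ d) :
    edgeSum m α a b a d = edgeIndicator α m b m d := by
  rw [edgeSum_of_pairLast hm hα (c := m) (d := d)
      ⟨.mk_left h1 h2 h3 h4 le_rfl h4'.le h5 (by omega) h6, by omega⟩,
    edgeSum_horizontal_right hm hα h1 (by omega) h3 h4' h6,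
    edgeSum_diagonal_right hm hα h1 h2 h3 h4 h4' h5, sub_zero]

/-- The coefficients of the Morse boundary of a critical `2`-face. The contributions of the critical
faces `[m, m; b, d]` and `[a, c; m, m]` cancel. -/
theorem finsum_mixedPath_conf (hm : 4 ≤ m) (hα : α ∈ confCritical m 1) (h : TypeL m a b c d) :
    ∑ᶠ l : MixedPath (confComplex m) (confField m) {col a b, col a d, col c d} α, l.mult =
      edgeIndicator α a d (m - 1) m - edgeIndicator α a b (m - 1) m +
        edgeIndicator α c b (m - 1) m - edgeIndicator α c d (m - 1) m := by
  have htri := h.isTriangle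
  obtain ⟨hl1, hl2⟩ := htri.lt
  have hcrit := h.mem_confCritical hm
  rw [finsum_mixedPath (acc_upStep hm) (triangle_mem htri)
    (by rw [card_triple_of_lt hl1 hl2]; omega)
    (fun δ hδ => (((mem_confCritical hm).1 hcrit).2.2 δ).2 ((mem_confField hm _).1 hδ)),
    Finset.sum_insert (by simp [hl1.ne, (hl1.trans hl2).ne]), Finset.sum_pair hl2.ne,
    erase_triple_left hl1 hl2, erase_triple_middle hl1 hl2, erase_triple_right hl1 hl2,
    position_triple_left hl1 hl2, position_triple_middle hl1 hl2, position_triple_right hl1 hl2]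
  obtain ⟨h1, h2, h3, h4, h5, h6, h7, h8, h9, h10⟩ := h
  change (-1) ^ 0 * edgeSum m α a d c d + ((-1) ^ 1 * edgeSum m α a b c d +
    (-1) ^ 2 * edgeSum m α a b a d) = _
  rw [edgeSum_of_pairMiddle hm hα (a := a) (b := b) (c := c) (d := d) (e := c) (f := b)
      ⟨.mk_right h1 h2 h3 h4 h5.le h6.le h7 h9 h10.symm, by omega⟩,
    edgeSum_horizontal hm hα h1 (by omega) h3 h5 h6 h8 h9,
    edgeSum_horizontal hm hα h1 h2 h3 h5 (by omega) h7 h10.symm,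
    edgeSum_vertical hm hα h1 h2 (by omega) h4 h6 h7 h8,
    edgeSum_vertical hm hα (by omega) h2 h5 h4 h6 h10.symm h9]
  ring

end

/-! ### The Morse boundary and coboundary -/

namespace FinComplex

section MorseBasis

variable {V : Type} [LinearOrder V] (R : Type*) [CommRing R] {K : FinComplex V}
  {W : Finset (Finset V × Finset V)} {p : ℕ}

theorem morseCell_apply (σ : Finset V) (τ : {σ // σ ∈ K.criticalFaces W p}) :
    morseCell R K W p σ τ = if σ = τ.1 then 1 else 0 := by
  classical
  unfold morseCell
  by_cases h : σ ∈ K.criticalFaces W p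
  · rw [dif_pos h, Finsupp.single_apply]
    simp only [Subtype.ext_iff]
  · rw [dif_neg h, if_neg fun h' : σ = τ.1 => h (h' ▸ τ.2)]
    rfl

theorem morseDual_apply_morseCell {σ τ : Finset V}
    (h : σ ∈ K.criticalFaces W p ∨ τ ∈ K.criticalFaces W p) :
    morseDual R K W p σ (morseCell R K W p τ) = if τ = σ then 1 else 0 := by
  unfold morseDual
  by_cases hσ : σ ∈ K.criticalFaces W p
  · rw [dif_pos hσ, Finsupp.lapply_apply, morseCell_apply]
  · rw [dif_neg hσ, if_neg]
    · rfl
    · rintro rfl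
      exact hσ (h.elim id id)

end MorseBasis

end FinComplex

section

variable (R : Type*) [CommRing R] {m a b c d : ℕ}

theorem confCell_eq_zero (p : ℕ) {σ : Finset (ℕ ×ₗ ℕ)} (h : σ ∉ confCritical m p) :
    confCell R m p σ = 0 := dif_neg h

theorem confBoundary_confCell (hm : 4 ≤ m) (h : TypeL m a b c d) :
    confBoundary R m (confCell R m 2 (cols !![a, a, c; b, d, d])) =
      confCell R m 1 (cols !![a, m - 1; d, m]) - confCell R m 1 (cols !![a, m - 1; b, m]) +
      confCell R m 1 (cols !![c, m - 1; b, m]) - confCell R m 1 (cols !![c, m - 1; d, m]) := by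
  classical
  have hcrit := h.mem_confCritical hm
  simp only [cols_edge, cols_triangle]
  refine Finsupp.ext fun α => ?_
  have hcell : confCell R m 2 {col a b, col a d, col c d} = Finsupp.single ⟨_, hcrit⟩ 1 :=
    dif_pos hcrit
  rw [hcell, confBoundary, morseBoundary, Finsupp.linearCombination_single, one_smul,
    Finsupp.finsetSum_apply, Finset.sum_eq_single α]
  · rw [Finsupp.single_apply, if_pos rfl, finsum_mixedPath_conf hm α.2 h]
    simp only [Finsupp.sub_apply, Finsupp.add_apply]
    have hc := fun σ => morseCell_apply R (K := confComplex m) (W := confField m) (p := 1) σ α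
    simp only [edgeIndicator, Int.cast_sub, Int.cast_add, Int.cast_ite, Int.cast_one, Int.cast_zero]
    rw [← hc, ← hc, ← hc, ← hc]
    rfl
  · intro x _ hx
    rw [Finsupp.single_apply, if_neg hx]
  · simp

/-- A cochain is determined by its values on the critical `2`-faces. -/
theorem confCochain_ext (hm : 4 ≤ m)
    {φ ψ : MorseCochain R (confComplex m) (confField m) 2}
    (h : ∀ a b c d, TypeL m a b c d → φ (confCell R m 2 {col a b, col a d, col c d}) =
      ψ (confCell R m 2 {col a b, col a d, col c d})) : φ = ψ := by
  refine Finsupp.lhom_ext' fun σ => LinearMap.ext_ring ?_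
  obtain ⟨a, b, c, d, hL, hσ⟩ := (mem_confCritical_two hm σ.1).1 σ.2
  rw [cols_triangle] at hσ
  have := h a b c d hL
  rw [← hσ, show confCell R m 2 σ.1 = Finsupp.single σ 1 from dif_pos σ.2] at this
  exact this

theorem confCoboundary_apply (hm : 4 ≤ m) {σ : Finset (ℕ ×ₗ ℕ)} (hσ : σ ∈ confCritical m 1)
    (h : TypeL m a b c d) :
    confCoboundary R m (confDual R m 1 σ) (confCell R m 2 {col a b, col a d, col c d}) =
      (if {col a d, col (m - 1) m} = σ then 1 else 0) -
      (if {col a b, col (m - 1) m} = σ then 1 else 0) +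
      (if {col c b, col (m - 1) m} = σ then 1 else 0) -
      (if {col c d, col (m - 1) m} = σ then 1 else 0) := by
  have hb := confBoundary_confCell R hm h
  simp only [cols_edge, cols_triangle] at hb
  change confDual R m 1 σ (confBoundary R m (confCell R m 2 _)) = _
  rw [hb]
  have hd := fun τ => morseDual_apply_morseCell R (K := confComplex m) (W := confField m) (p := 1)
    (σ := σ) (τ := τ) (Or.inl hσ)
  simp only [map_sub, map_add, confDual, confCell, hd]

end

section

variable {m a b c d a' b' c' d' : ℕ}

/-- A sum of indicators in which only the index `q` can contribute, and does so if and only if `P`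
holds. -/
theorem sum_indicator {ι σ : Type*} [DecidableEq σ] {R : Type*} [CommRing R] (s : Finset ι)
    (f : ι → σ) (τ : σ) (q : ι) (P : Prop) [Decidable P] (h : ∀ p ∈ s, τ = f p → p = q ∧ P)
    (h' : P → q ∈ s ∧ τ = f q) :
    ∑ p ∈ s, (if τ = f p then (1 : R) else 0) = if P then 1 else 0 := by
  by_cases hP : P
  · obtain ⟨hq, hτ⟩ := h' hP
    rw [Finset.sum_eq_single_of_mem q hq fun p hp hne => if_neg fun he => hne (h p hp he).1,
      if_pos hτ, if_pos hP]
  · rw [if_neg hP]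
    exact Finset.sum_eq_zero fun p hp => if_neg fun he => hP (h p hp he).2

theorem edge_K1_eq_iff (ha : a < m) (hb : b < m) (ha' : a' < m) (hb' : b' < m) :
    ({col a b, col (m - 1) m} : Finset (ℕ ×ₗ ℕ)) = {col a' b', col (m - 1) m} ↔
      a = a' ∧ b = b' := by
  rw [edge_eq_iff (by rw [col_lt]; omega) (by rw [col_lt]; omega)]
  tauto

theorem triangle_left_eq_iff (h1 : a < c) (h2 : b < d) (h1' : a' < c') (h2' : b' < d') :
    ({col a b, col a d, col c d} : Finset (ℕ ×ₗ ℕ)) = {col a' b', col a' d', col c' d'} ↔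
      a = a' ∧ b = b' ∧ c = c' ∧ d = d' := by
  rw [triangle_eq_iff (by rw [col_lt, col_lt]; omega) (by rw [col_lt, col_lt]; omega)]
  tauto

theorem TypeK1.lt (h : TypeK1 m a b) : 1 ≤ a ∧ 1 ≤ b ∧ a ≠ b ∧ a < m ∧ b < m := by
  obtain ⟨h1, h2, h3, h4⟩ := h
  refine ⟨h1, h2, h3, ?_, ?_⟩ <;> omega

/-- In each of the four sums the face `[a', a', c'; b', d', d']` occurs at most once, at the index
formed by the two of its parameters which are not prescribed. -/
theorem confCoboundary_K1 (R : Type*) [CommRing R] (hm : 4 ≤ m) (h : TypeK1 m a b) :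
    confCoboundary R m (confDual R m 1 (cols !![a, m - 1; b, m])) =
        (∑ p ∈ Finset.Icc 1 m ×ˢ Finset.Icc 1 m with
            a < p.1 ∧ p.1 < m ∧ p.2 < b ∧ b ≠ p.1 ∧ p.1 ≠ p.2 ∧ p.2 ≠ a,
          confDual R m 2 (cols !![a, a, p.1; p.2, b, b])) -
        (∑ p ∈ Finset.Icc 1 m ×ˢ Finset.Icc 1 m with
            a < p.1 ∧ p.1 < m ∧ b < p.2 ∧ p.2 < m ∧ b ≠ p.1 ∧ p.1 ≠ p.2 ∧ p.2 ≠ a,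
          confDual R m 2 (cols !![a, a, p.1; b, p.2, p.2])) +
        (∑ p ∈ Finset.Icc 1 m ×ˢ Finset.Icc 1 m with
            p.1 < a ∧ b < p.2 ∧ p.2 < m ∧ b ≠ p.1 ∧ p.1 ≠ p.2 ∧ p.2 ≠ a,
          confDual R m 2 (cols !![p.1, p.1, a; b, p.2, p.2])) -
        (∑ p ∈ Finset.Icc 1 m ×ˢ Finset.Icc 1 m with
            p.1 < a ∧ p.2 < b ∧ b ≠ p.1 ∧ p.1 ≠ p.2 ∧ p.2 ≠ a,
          confDual R m 2 (cols !![p.1, p.1, a; p.2, b, b])) := by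
  classical
  simp only [cols_edge, cols_triangle]
  refine confCochain_ext R hm fun a' b' c' d' hL => ?_
  have hcrit := hL.mem_confCritical hm
  have hd := fun σ => morseDual_apply_morseCell R (K := confComplex m) (W := confField m) (p := 2)
    (σ := σ) (Or.inr hcrit)
  obtain ⟨k1, k2, k3, k4, k5⟩ := h.lt
  obtain ⟨h1, h2, h3, h4, h5, h6, h7, h8, h9, h10⟩ := id hL
  rw [confCoboundary_apply R hm (h.mem_confCritical hm) hL]
  simp only [LinearMap.sub_apply, LinearMap.add_apply, LinearMap.sum_apply]
  simp only [confDual, confCell, hd]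
  rw [sum_indicator _ _ _ (c', b') (a' = a ∧ d' = b),
    sum_indicator _ _ _ (c', d') (a' = a ∧ b' = b),
    sum_indicator _ _ _ (a', d') (c' = a ∧ b' = b), sum_indicator _ _ _ (a', b') (c' = a ∧ d' = b)]
  · simp only [edge_K1_eq_iff (h3.trans h5) h6 k4 k5,
      edge_K1_eq_iff (h3.trans h5) (h4.trans h6) k4 k5,
      edge_K1_eq_iff h5 h6 k4 k5, edge_K1_eq_iff h5 (h4.trans h6) k4 k5]
  all_goals simp only [Finset.mem_filter, Finset.mem_product, Finset.mem_Icc]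
  · rintro ⟨x, y⟩ ⟨-, g1, g2, -⟩ he
    obtain ⟨rfl, rfl, rfl, rfl⟩ := (triangle_left_eq_iff h3 h4 g1 g2).1 he
    exact ⟨rfl, rfl, rfl⟩
  · rintro ⟨rfl, rfl⟩
    refine ⟨?_, rfl⟩
    omega
  · rintro ⟨x, y⟩ ⟨-, g1, g2, -⟩ he
    obtain ⟨rfl, rfl, rfl, rfl⟩ := (triangle_left_eq_iff h3 h4 g1 g2).1 he
    exact ⟨rfl, rfl, rfl⟩
  · rintro ⟨rfl, rfl⟩
    refine ⟨?_, rfl⟩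
    omega
  · rintro ⟨x, y⟩ ⟨-, g1, -, g2, -⟩ he
    obtain ⟨rfl, rfl, rfl, rfl⟩ := (triangle_left_eq_iff h3 h4 g1 g2).1 he
    exact ⟨rfl, rfl, rfl⟩
  · rintro ⟨rfl, rfl⟩
    refine ⟨?_, rfl⟩
    omega
  · rintro ⟨x, y⟩ ⟨-, g1, -, g2, -⟩ he
    obtain ⟨rfl, rfl, rfl, rfl⟩ := (triangle_left_eq_iff h3 h4 g1 g2).1 he
    exact ⟨rfl, rfl, rfl⟩
  · rintro ⟨rfl, rfl⟩
    refine ⟨?_, rfl⟩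
    omega

/-- Critical `1`-faces other than those of the form `[a, m-1; b, m]` do not occur in the boundary of
any critical `2`-face. -/
theorem confCoboundary_eq_zero (R : Type*) [CommRing R] (hm : 4 ≤ m)
    (hσ : {col a b, col c d} ∈ confCritical m 1) (h : col a b < col c d)
    (hcd : c ≠ m - 1 ∨ d ≠ m) :
    confCoboundary R m (confDual R m 1 (cols !![a, c; b, d])) = 0 := by
  rw [cols_edge]
  refine confCochain_ext R hm fun a' b' c' d' hL => ?_
  rw [confCoboundary_apply R hm hσ hL]
  obtain ⟨h1, h2, h3, h4, h5, h6, -⟩ := hL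
  have hne : ∀ x y, x < m → y < m →
      ({col x y, col (m - 1) m} : Finset (ℕ ×ₗ ℕ)) ≠ {col a b, col c d} := by
    intro x y hx hy he
    rw [edge_eq_iff (by rw [col_lt]; omega) h] at he
    omega
  rw [if_neg (hne _ _ (by omega) (by omega)), if_neg (hne _ _ (by omega) (by omega)),
    if_neg (hne _ _ (by omega) (by omega)), if_neg (hne _ _ (by omega) (by omega))]
  simp

end

end

theorem proposition4p3 (R : Type*) [CommRing R] (m : ℕ) (hm : 4 ≤ m) :
    -- the matching constructed by the algorithm is a gradient field, so all path sums are finite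
    (confComplex m).IsGradientField (confField m) ∧
    -- the critical `1`-faces are those of types (k.1), (k.2) and (k.3)
    (∀ σ, σ ∈ confCritical m 1 ↔
      (∃ a b, TypeK1 m a b ∧ σ = cols !![a, m - 1; b, m]) ∨
      (∃ b d, TypeK23 m b d ∧ σ = cols !![m, m; b, d]) ∨
      (∃ a c, TypeK23 m a c ∧ σ = cols !![a, c; m, m])) ∧
    -- the critical `2`-faces
    (∀ σ, σ ∈ confCritical m 2 ↔
      ∃ a b c d, TypeL m a b c d ∧ σ = cols !![a, a, c; b, d, d]) ∧
    -- the coboundary vanishes on the duals of the critical faces of types (k.2) and (k.3)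
    (∀ b d, TypeK23 m b d → confCoboundary R m (confDual R m 1 (cols !![m, m; b, d])) = 0) ∧
    (∀ a c, TypeK23 m a c → confCoboundary R m (confDual R m 1 (cols !![a, c; m, m])) = 0) ∧
    -- the coboundary on the duals of the critical faces of type (k.1)
    (∀ a b, TypeK1 m a b →
      confCoboundary R m (confDual R m 1 (cols !![a, m - 1; b, m])) =
        (∑ p ∈ Finset.Icc 1 m ×ˢ Finset.Icc 1 m with
            a < p.1 ∧ p.1 < m ∧ p.2 < b ∧ b ≠ p.1 ∧ p.1 ≠ p.2 ∧ p.2 ≠ a,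
          confDual R m 2 (cols !![a, a, p.1; p.2, b, b])) -
        (∑ p ∈ Finset.Icc 1 m ×ˢ Finset.Icc 1 m with
            a < p.1 ∧ p.1 < m ∧ b < p.2 ∧ p.2 < m ∧ b ≠ p.1 ∧ p.1 ≠ p.2 ∧ p.2 ≠ a,
          confDual R m 2 (cols !![a, a, p.1; b, p.2, p.2])) +
        (∑ p ∈ Finset.Icc 1 m ×ˢ Finset.Icc 1 m with
            p.1 < a ∧ b < p.2 ∧ p.2 < m ∧ b ≠ p.1 ∧ p.1 ≠ p.2 ∧ p.2 ≠ a,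
          confDual R m 2 (cols !![p.1, p.1, a; b, p.2, p.2])) -
        (∑ p ∈ Finset.Icc 1 m ×ˢ Finset.Icc 1 m with
            p.1 < a ∧ p.2 < b ∧ b ≠ p.1 ∧ p.1 ≠ p.2 ∧ p.2 ≠ a,
          confDual R m 2 (cols !![p.1, p.1, a; p.2, b, b]))) ∧
    -- the summation ranges consist exactly of the `x` and `y` which render critical `2`-faces
    (∀ a b, TypeK1 m a b → ∀ x y : ℕ,
      (cols !![a, a, x; y, b, b] ∈ confCritical m 2 ↔
        1 ≤ y ∧ a < x ∧ x < m ∧ y < b ∧ b ≠ x ∧ x ≠ y ∧ y ≠ a) ∧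
      (cols !![a, a, x; b, y, y] ∈ confCritical m 2 ↔
        a < x ∧ x < m ∧ b < y ∧ y < m ∧ b ≠ x ∧ x ≠ y ∧ y ≠ a) ∧
      (cols !![x, x, a; b, y, y] ∈ confCritical m 2 ↔
        1 ≤ x ∧ x < a ∧ b < y ∧ y < m ∧ b ≠ x ∧ x ≠ y ∧ y ≠ a) ∧
      (cols !![x, x, a; y, b, b] ∈ confCritical m 2 ↔
        1 ≤ x ∧ 1 ≤ y ∧ x < a ∧ y < b ∧ b ≠ x ∧ x ≠ y ∧ y ≠ a)) ∧
    -- the boundary of the critical `2`-faces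
    (∀ a b c d, TypeL m a b c d → (c, d) ≠ (m - 1, m - 2) →
      confBoundary R m (confCell R m 2 (cols !![a, a, c; b, d, d])) =
        confCell R m 1 (cols !![a, m - 1; d, m]) - confCell R m 1 (cols !![a, m - 1; b, m]) +
        confCell R m 1 (cols !![c, m - 1; b, m]) - confCell R m 1 (cols !![c, m - 1; d, m])) ∧
    (∀ a b, TypeL m a b (m - 1) (m - 2) →
      confBoundary R m (confCell R m 2 (cols !![a, a, m - 1; b, m - 2, m - 2])) =
        confCell R m 1 (cols !![a, m - 1; m - 2, m]) -
        confCell R m 1 (cols !![a, m - 1; b, m]) +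
        confCell R m 1 (cols !![m - 1, m - 1; b, m])) := by
  refine ⟨isGradientField_confField hm, mem_confCritical_one hm, mem_confCritical_two hm,
    fun b d h => ?_, fun a c h => ?_, fun a b h => confCoboundary_K1 R hm h, fun a b h x y => ?_,
    fun a b c d h _ => confBoundary_confCell R hm h, fun a b h => ?_⟩
  · exact confCoboundary_eq_zero R hm (h.mem_confCritical_left hm)
      (by rw [col_lt]; exact Or.inr ⟨rfl, h.2.1⟩) (by omega)
  · exact confCoboundary_eq_zero R hm (h.mem_confCritical_right hm)
      (by rw [col_lt]; exact Or.inl h.2.1) (Or.inl h.2.2.ne)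
  · obtain ⟨k1, k2, k3, k4, k5⟩ := h.lt
    simp only [cols_mem_confCritical_two hm]
    refine ⟨⟨?_, ?_⟩, ⟨?_, ?_⟩, ⟨?_, ?_⟩, ⟨?_, ?_⟩⟩
    · rintro ⟨h1, h2, h3, h4, h5, h6, h7, h8, h9, h10⟩
      exact ⟨h2, h3, h5, h4, h9.symm, h10.symm, h7.symm⟩
    · rintro ⟨h1, h2, h3, h4, h5, h6, h7⟩
      exact ⟨k1, h1, h2, h4, h3, k5, h7.symm, k3, h5.symm, h6.symm⟩
    · rintro ⟨h1, h2, h3, h4, h5, h6, h7, h8, h9, h10⟩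
      exact ⟨h3, h5, h4, h6, h10, h9, h8.symm⟩
    · rintro ⟨h1, h2, h3, h4, h5, h6, h7⟩
      exact ⟨k1, k2, h1, h3, h2, h4, k3, h7.symm, h6, h5⟩
    · rintro ⟨h1, h2, h3, h4, h5, h6, h7, h8, h9, h10⟩
      exact ⟨h1, h3, h4, h6, h7.symm, h8, h9.symm⟩
    · rintro ⟨h1, h2, h3, h4, h5, h6, h7⟩
      exact ⟨h1, k2, h2, h3, k4, h4, h5.symm, h6, h7.symm, k3.symm⟩
    · rintro ⟨h1, h2, h3, h4, h5, h6, h7, h8, h9, h10⟩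
      exact ⟨h1, h2, h3, h4, h8.symm, h7, h10⟩
    · rintro ⟨h1, h2, h3, h4, h5, h6, h7⟩
      exact ⟨h1, h2, h3, h4, k4, k5, h6, h5.symm, k3, h7⟩
  · -- the face `[m-1, m-1; m-2, m]` is not critical, it is paired with its vertex `[m-1; m]`
    rw [confBoundary_confCell R hm h, confCell_eq_zero R 1 (σ := cols !![m - 1, m - 1; m - 2, m]),
      sub_zero]
    rw [cols_edge, mem_confCritical hm]
    exact fun hcrit => (hcrit.2.2 _).2 .first
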